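/- Let $\mathcal A=(\mathcal S,A,D,\cdot)$ be a Markov automaton: $\mathcal S$ is a finite set of states, $A$ a finite alphabet, $D$ a probability distribution on $A$ with $D(a)>0$ for all $a\in A$, and $(x,a)\mapsto x\cdot a$ a map $\mathcal S\times A\to\mathcal S$. Its transition matrix is $M(x,y)=D(\{a : x\cdot a=y\})$. Let $\mathcal B$ be a family of subsets of $\mathcal S$ containing $\mathcal S$, and let $\circ:\mathcal B\times A\to\mathcal B$ be an operator that induces a bounding chain, i.e. $x\in B\Rightarrow x\cdot a\in B\circ a$; assume that $\circ$ is monotone ($B\subseteq B'\Rightarrow B\circ a\subseteq B'\circ a$) and maps singletons to singletons (if $\{x\}\in\mathcal B$ then $\{x\}\circ a=\{x\cdot a\}$). Add to $A$ a delimiter $\sharp$ with $x\cdot\sharp=x$ and $B\circ\sharp=B$, and write $\mathcal S\circ w$ for the set obtained from $\mathcal S$ by applying successively the letters of the finite word $w$ over $A\cup\{\sharp\}$. After a history $h$ (a finite word), a letter $a\in A$ is *passive* if $\mathcal S\circ h\circ a=\mathcal S\circ h$; the other letters of $A$, and always $\sharp$, are *active*; $\mathrm{Pas}_h$ and $\mathrm{Act}_h$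 denote the sets of passive and active letters. For $q\in(0,1]$ let $D_q(\sharp)=q$ and $D_q(a)=(1-q)D(a)$ for $a\in A$, and let $G_q$ be the law of an infinite i.i.d. word with letter law $D_q$, truncated just after its first $\sharp$. * *Contraction.* $c^h(\epsilon)=\epsilon$; $c^h(a\cdot u)=a\cdot c^{h\cdot a}(u)$ if $a\in\mathrm{Act}_h$, and $c^h(a\cdot u)=c^h(u)$ otherwise. * *Expansion* (a random word). $e_q^h(\epsilon)=\epsilon$; $e_q^h(a\cdot u)=p\cdot e_q^h(a\cdot u)$ with probability $D_q(\mathrm{Pas}_h)$, where $p$ is a fresh letter of law $D_q(\,\cdot\mid\mathrm{Pas}_h)$, and $e_q^h(a\cdot u)=a\cdot e_q^{h\cdot a}(u)$ with probability $D_q(\mathrm{Act}_h)$. * *$\mathcal G$-expansion.* A word $v$ ending with its $n$th $\sharp$ is cut as $v=v^n\cdots v^1$, each $v^m$ containing exactly one $\sharp$, as its last letter, and $e_{\mathcal G}(v)=e^{\epsilon}_{2^{-n}}(v^n)\cdots e^{v^n\cdots v^{m+1}}_{2^{-m}}(v^m)\cdots e^{v^n\cdots v^2}_{1/2}(v^1)$,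 with independent draws; $e_{\mathcal G}(\epsilon)=\epsilon$. Let $(u^m)_{m\in\mathbb N}$ be independent random words with $u^m\sim G_{2^{-m}}$, let $w^0=\epsilon$ and $w^{n+1}=c^{\epsilon}\big(u^{n+1}\cdot e_{\mathcal G}(w^n)\big)$, where the draws made in each expansion are independent of the words $u^m$ and of the earlier expansions, and let $N=\inf\{n\in\mathbb N : |\mathcal S\circ w^n|=1\}$. **Theorem.** Suppose that there is a coupling word for the bounding chain, i.e. a word $v\in A^*$ such that $\mathcal S\circ v$ is a singleton. Then $\mathbb P\{N<+\infty\}=1$ and $\mathbb E[N]<+\infty$. Furthermore, $\mathcal A$ has a unique stationary distribution $\pi$ (i.e. $\pi M=\pi$), and the unique element of $\mathcal S\circ w^N$ is distributed according to $\pi$. -/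

import Mathlib

open MeasureTheory ProbabilityTheory
open scoped ENNReal NNReal

noncomputable section

namespace OracleCFTP

/-- A Markov automaton with state space `S` and alphabet `A`: a probability distribution `dist` on
the letters, charging every letter, and an action of the letters on the states. (Finiteness of `S`
and `A` is assumed in the theorem.) -/
structure MarkovAutomaton (S A : Type*) where
  dist : PMF A
  act : S → A → S
  dist_pos : ∀ a, 0 < dist a

/-- Letters of the extended alphabet `A ∪ {♯}`: the delimiter `♯` is `none`. -/
abbrev Letter (A : Type*) := Option A

/-- Finite words over the extended alphabet. -/
abbrev Word (A : Type*) := List (Letter A)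

instance instMeasurableSpaceLetter (A : Type*) : MeasurableSpace (Letter A) := ⊤

instance instMeasurableSpaceWord (A : Type*) : MeasurableSpace (Word A) := ⊤

variable {S A : Type*}

theorem tsum_letter (f : Letter A → ℝ≥0∞) : ∑' l, f l = f none + ∑' a, f (some a) := by
  rw [← (Equiv.optionEquivSumPUnit.{0} A).symm.tsum_eq,
    (HasSum.sum ENNReal.summable.hasSum ENNReal.summable.hasSum).tsum_eq]
  simp [add_comm]

theorem tsum_word (f : Word A → ℝ≥0∞) : ∑' w, f w = f [] + ∑' b, ∑' w, f (b :: w) := by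
  let e : Option (Letter A × Word A) ≃ Word A :=
    { toFun := fun o => o.elim [] (fun p => p.1 :: p.2)
      invFun := fun w => match w with
        | [] => none
        | b :: w => some (b, w)
      left_inv := by rintro (_ | ⟨b, w⟩) <;> rfl
      right_inv := by rintro (_ | ⟨b, w⟩) <;> rfl }
  rw [← e.tsum_eq, tsum_letter, ENNReal.tsum_prod']
  rfl

namespace MarkovAutomaton

/-- One step of the Markov chain generated by the automaton, from the state `x`: the law of `x · a`
for a random letter `a`. These laws are the rows of the transition matrix. -/
def trans (M : MarkovAutomaton S A) (x : S) : PMF S := M.dist.map (M.act x)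

/-- `π` is a stationary distribution of the automaton. -/
def IsStationary (M : MarkovAutomaton S A) (π : PMF S) : Prop := π.bind M.trans = π

/-- The distribution `D_q` on `A ∪ {♯}`, with `D_q(♯) = q` and `D_q(a) = (1 - q) D(a)`. -/
def delimDist (M : MarkovAutomaton S A) (q : Set.Ioc (0 : ℝ≥0) 1) : PMF (Letter A) :=
  ⟨fun l => l.elim ((q : ℝ≥0) : ℝ≥0∞) (fun a => (1 - ((q : ℝ≥0) : ℝ≥0∞)) * M.dist a), by
    refine ENNReal.summable.hasSum_iff.2 ?_
    rw [tsum_letter]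
    simp only [Option.elim]
    rw [ENNReal.tsum_mul_left, M.dist.tsum_coe, mul_one]
    exact add_tsub_cancel_of_le (by exact_mod_cast q.2.2)⟩

open Classical in
/-- An infinite word truncated just after the first `♯` (the value is junk if there is no `♯`). -/
def truncate (s : ℕ → Letter A) : Word A :=
  if h : ∃ i, s i = none then (List.range (Nat.find h + 1)).map s else []

/-- The distribution `G_q`: the law of an infinite word with independent letters of law `D_q`,
truncated just after the first `♯`. -/
def sharpWordLaw (M : MarkovAutomaton S A) (q : Set.Ioc (0 : ℝ≥0) 1) : Measure (Word A) :=
  (Measure.infinitePi (fun _ : ℕ => (M.delimDist q).toMeasure)).map truncate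

end MarkovAutomaton

/-- The parameter `2^{-m}`. -/
def halfPow (m : ℕ) : Set.Ioc (0 : ℝ≥0) 1 :=
  ⟨(2 : ℝ≥0)⁻¹ ^ m, by positivity, pow_le_one₀ (by positivity) (by norm_num)⟩

/-- A pair `(𝔅, ∘)` inducing a bounding chain for the grand coupling of the automaton: a family of
sets of states containing the whole state space, on which the letters act compatibly. -/
structure BoundingChain (M : MarkovAutomaton S A) where
  sets : Set (Set S)
  univ_mem : Set.univ ∈ sets
  op : sets → A → sets
  act_mem : ∀ (B : sets) (a : A) (x : S), x ∈ (B : Set S) → M.act x a ∈ (op B a : Set S)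

namespace BoundingChain

variable {M : MarkovAutomaton S A} (C : BoundingChain M)

/-- The operator `∘` is monotone for inclusion. -/
def IsMonotone : Prop :=
  ∀ (B B' : C.sets) (a : A), (B : Set S) ⊆ B' → (C.op B a : Set S) ⊆ C.op B' a

/-- The operator `∘` maps singletons to singletons. -/
def PreservesSingletons : Prop :=
  ∀ (B : C.sets) (a : A) (x : S), (B : Set S) = {x} → (C.op B a : Set S) = {M.act x a}

/-- Action of the extended alphabet: `♯` leaves every set unchanged. -/
def step (B : C.sets) (l : Letter A) : C.sets := l.elim B (C.op B)

/-- `S ∘ w`: the value of the bounding chain after reading `w` from the whole state space. -/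
def read (w : Word A) : C.sets := w.foldl C.step ⟨Set.univ, C.univ_mem⟩

/-- `S ∘ w` is a singleton. -/
def Couples (w : Word A) : Prop := ∃ x : S, (C.read w : Set S) = {x}

/-- The letters that are active after the history `h`; `♯` is always active. -/
def active (h : Word A) : Set (Letter A) := {l | l = none ∨ C.step (C.read h) l ≠ C.read h}

/-- The letters that are passive after the history `h`. -/
def passive (h : Word A) : Set (Letter A) := {l | l ≠ none ∧ C.step (C.read h) l = C.read h}

open Classical in
/-- The `h`-contraction of a word. -/
def contract : Word A → Word A → Word A
  | _, [] => []
  | h, a :: u => if a ∈ C.active h then a :: contract (h ++ [a]) u else contract h u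

open Classical in
/-- `C.expandWeight q h u v` is the probability that the `(h, q)`-expansion of `u` is `v`.
The recursion reads off the first letter `b` of the output: for `u = a ⬝ u'`, with probability
`D_q(passive)` it is a passive letter of law `D_q(· | passive)` and the expansion of `u` continues
(so that a given passive `b` arises with probability `D_q(b)`); with probability `D_q(active)` it
is `a`, and the expansion of `u'` continues with history `h ⬝ a`. -/
def expandWeight (q : Set.Ioc (0 : ℝ≥0) 1) : Word A → Word A → Word A → ℝ≥0∞
  | _, [], [] => 1
  | _, [], _ :: _ => 0
  | _, _ :: _, [] => 0
  | h, a :: u, b :: v =>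
      (if b ∈ C.passive h then M.delimDist q b * expandWeight q h (a :: u) v else 0) +
      (if b = a then (M.delimDist q).toOuterMeasure (C.active h) *
        expandWeight q (h ++ [a]) u v else 0)

theorem mass_active_add_passive (q : Set.Ioc (0 : ℝ≥0) 1) (h : Word A) :
    (M.delimDist q).toOuterMeasure (C.passive h) +
      (M.delimDist q).toOuterMeasure (C.active h) = 1 := by
  classical
  rw [PMF.toOuterMeasure_apply, PMF.toOuterMeasure_apply, ← ENNReal.tsum_add,
    ← (M.delimDist q).tsum_coe]
  refine tsum_congr fun l => ?_
  by_cases hl : l ∈ C.active h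
  · have : l ∉ C.passive h := by
      intro hp
      rcases hl with hl | hl
      · exact hp.1 hl
      · exact hl hp.2
    simp [hl, this]
  · have : l ∈ C.passive h := by
      exact not_not.1 fun hp => hl (by
        by_cases h0 : l = none
        · exact Or.inl h0
        · exact Or.inr fun h1 => hp ⟨h0, h1⟩)
    simp [hl, this]

theorem mass_active_pos (q : Set.Ioc (0 : ℝ≥0) 1) (h : Word A) :
    (M.delimDist q).toOuterMeasure (C.active h) ≠ 0 := by
  rw [PMF.toOuterMeasure_apply]
  intro h0
  have h1 := ENNReal.tsum_eq_zero.1 h0 none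
  rw [Set.indicator_of_mem (show (none : Letter A) ∈ C.active h from Or.inl rfl)] at h1
  have h2 : ((q : ℝ≥0) : ℝ≥0∞) = 0 := h1
  have h3 : (q : ℝ≥0) ≠ 0 := q.2.1.ne'
  exact h3 (by exact_mod_cast h2)

open Classical in
theorem tsum_expandWeight_cons (q : Set.Ioc (0 : ℝ≥0) 1) (h : Word A) (a : Letter A) (u : Word A)
    (g : Word A → ℝ≥0∞) :
    ∑' v, (C.expandWeight q h (a :: u) v) * g v =
      (∑' b, (C.passive h).indicator (M.delimDist q) b *
        ∑' v, C.expandWeight q h (a :: u) v * g (b :: v)) +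
      (M.delimDist q).toOuterMeasure (C.active h) *
        ∑' v, C.expandWeight q (h ++ [a]) u v * g (a :: v) := by
  rw [tsum_word]
  simp only [expandWeight, zero_mul, zero_add, add_mul, ENNReal.tsum_add, ite_mul]
  congr 1
  · refine tsum_congr fun b => ?_
    by_cases hb : b ∈ C.passive h
    · simp [hb, mul_assoc, ENNReal.tsum_mul_left]
    · simp [hb]
  · rw [tsum_eq_single a]
    · simp [mul_assoc, ENNReal.tsum_mul_left]
    · intro b hb
      simp [hb]

open Classical in
theorem tsum_expandWeight_trunc (q : Set.Ioc (0 : ℝ≥0) 1) (k : ℕ) (h u : Word A) :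
    ∑' v, C.expandWeight q h u v * (if v.length < k then 1 else 0) ≤ 1 := by
  induction k generalizing h u with
  | zero => simp
  | succ k ih =>
    cases u with
    | nil =>
      rw [tsum_word]
      simp [expandWeight]
    | cons a u =>
      rw [tsum_expandWeight_cons]
      simp only [List.length_cons, add_lt_add_iff_right]
      rw [ENNReal.tsum_mul_right, ← PMF.toOuterMeasure_apply]
      refine le_trans (add_le_add ?_ ?_) (C.mass_active_add_passive q h).le
      · exact mul_le_of_le_one_right' (ih _ _)
      · exact mul_le_of_le_one_right' (ih _ _)

theorem tsum_expandWeight_le (q : Set.Ioc (0 : ℝ≥0) 1) (h u : Word A) :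
    ∑' v, C.expandWeight q h u v ≤ 1 := by
  classical
  rw [ENNReal.tsum_eq_iSup_sum]
  refine iSup_le fun s => ?_
  refine le_trans ?_ (C.tsum_expandWeight_trunc q (s.sup List.length + 1) h u)
  refine le_trans (Finset.sum_le_sum fun v hv => ?_) (ENNReal.sum_le_tsum s)
  have : v.length < s.sup List.length + 1 :=
    Nat.lt_succ_of_le (Finset.le_sup (f := List.length) hv)
  simp [this]

theorem tsum_expandWeight (q : Set.Ioc (0 : ℝ≥0) 1) (h u : Word A) :
    ∑' v, C.expandWeight q h u v = 1 := by
  induction u generalizing h with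
  | nil =>
    rw [tsum_word]
    simp [expandWeight]
  | cons a u ih =>
    have key := C.tsum_expandWeight_cons q h a u (fun _ => 1)
    simp only [mul_one] at key
    rw [ENNReal.tsum_mul_right, ← PMF.toOuterMeasure_apply, ih, mul_one] at key
    have hs := C.mass_active_add_passive q h
    have hT : ∑' v, C.expandWeight q h (a :: u) v ≠ ∞ :=
      ne_top_of_le_ne_top ENNReal.one_ne_top (C.tsum_expandWeight_le q h (a :: u))
    have hpos := C.mass_active_pos q h
    generalize ∑' v, C.expandWeight q h (a :: u) v = T at key hT ⊢
    generalize (M.delimDist q).toOuterMeasure (C.passive h) = x at key hs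
    generalize (M.delimDist q).toOuterMeasure (C.active h) = y at key hs hpos
    have hx' : x ≠ ∞ := ne_top_of_le_ne_top ENNReal.one_ne_top (hs ▸ le_self_add)
    have hy' : y ≠ ∞ := ne_top_of_le_ne_top ENNReal.one_ne_top (hs ▸ le_add_self)
    lift T to ℝ≥0 using hT
    lift x to ℝ≥0 using hx'
    lift y to ℝ≥0 using hy'
    norm_cast at key hs hpos ⊢
    have h1 : x * T + y * T = x * T + y := by rw [← add_mul, hs, one_mul]; exact key
    have h2 : T * y = 1 * y := by rw [mul_comm, add_left_cancel h1, one_mul]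
    exact mul_right_cancel₀ hpos h2

/-- The law of the `(h, q)`-expansion of `u`. -/
def expand (q : Set.Ioc (0 : ℝ≥0) 1) (h u : Word A) : PMF (Word A) :=
  ⟨C.expandWeight q h u, C.tsum_expandWeight q h u ▸ ENNReal.summable.hasSum⟩

end BoundingChain

/-- Decomposition of a word after each of its letters `♯`: a word with `n` letters `♯` that is empty
or ends with `♯` is cut into `n` blocks, each of which contains exactly one `♯`, as its last
letter. -/
def blocks : Word A → List (Word A)
  | [] => []
  | none :: u => [none] :: blocks u
  | some a :: u =>
    match blocks u with
    | [] => [[some a]]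
    | b :: bs => (some a :: b) :: bs

namespace BoundingChain

variable {M : MarkovAutomaton S A} (C : BoundingChain M)

/-- Independent expansions of successive blocks, after the history `h`: a block followed by `k`
further blocks is expanded with parameter `2^{-(k+1)}`, its history being `h` followed by all the
preceding (unexpanded) blocks. -/
def expandBlocks : Word A → List (Word A) → PMF (Word A)
  | _, [] => PMF.pure []
  | h, b :: bs =>
    (C.expand (halfPow (bs.length + 1)) h b).bind fun x =>
      (expandBlocks (h ++ b) bs).map fun y => x ++ y

/-- The law of the `𝒢`-expansion of a word that is empty or ends with `♯`. -/
def gExpand (v : Word A) : PMF (Word A) := C.expandBlocks [] (blocks v)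

/-- `u`, `e`, `w` are the random words of a run of coupling from the past with oracle skipping:
the `u m` are independent with laws `G_{2^{-m}}`, the word `e n` is the random word `e_𝒢(w n)`
drawn at iteration `n`, and `w (n + 1) = c^ε (u (n + 1) ⬝ e_𝒢(w n))`.

The draws made in the `n`-th expansion are independent of everything else, namely of all the words
`u m` and of the earlier expansions: given these, `e n` has law `C.gExpand (w n)`. -/
structure IsRun {Ω : Type*} [MeasurableSpace Ω] (P : Measure Ω) (u e w : ℕ → Ω → Word A) :
    Prop where
  measurable_u : ∀ m, Measurable (u m)
  measurable_e : ∀ n, Measurable (e n)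
  law_u : ∀ m, P.map (u m) = M.sharpWordLaw (halfPow m)
  indep_u : iIndepFun u P
  law_e : ∀ (n k : ℕ) (x y : ℕ → Word A) (z v : Word A),
    P {ω | (∀ i < k, u i ω = x i) ∧ (∀ i < n, e i ω = y i) ∧ w n ω = z ∧ e n ω = v} =
      P {ω | (∀ i < k, u i ω = x i) ∧ (∀ i < n, e i ω = y i) ∧ w n ω = z} * C.gExpand z v
  w_zero : ∀ ω, w 0 ω = []
  w_succ : ∀ n ω, w (n + 1) ω = C.contract [] (u (n + 1) ω ++ e n ω)

/-- `N = inf {n | S ∘ wⁿ is a singleton}`, with value `∞` if there is no such `n`. -/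
def firstCoupling {Ω : Type*} (w : ℕ → Ω → Word A) (ω : Ω) : ℕ∞ :=
  ⨅ n ∈ {n : ℕ | C.Couples (w n ω)}, (n : ℕ∞)

end BoundingChain

end OracleCFTP

end

noncomputable section

namespace OracleCFTP

variable {S A : Type*}

/-! Three facts carry the proof. First, neither operation affects the bounding chain: contraction
deletes only letters that fix the current set, and expansion inserts only such letters
(`read_contract`, `read_of_mem_support_gExpand`). With monotonicity, the sets 𝒮 ∘ wⁿ therefore
decrease almost surely along a run.

Second, expanding the contraction of a word of law G_q restores the law G_q
(`tsum_sharpWeight_mul_expandWeight_contract`). Block by block, `e_𝒢` undoes in law the contraction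
of a concatenation of independent G-words, so wⁿ has the law of c^ε(uⁿ ⋯ u¹), as in ordinary
coupling from the past (`measure_future_inter_w`).

Third, a word of law G_q fails to couple with probability O(q) (`prod_mul_missProb_le`). With q =
2⁻ⁿ these probabilities are summable, and N is at most the number of n for which wⁿ does not couple;
hence E[N] < ∞.

For the law of the limit, let X have a stationary law π and be independent of a past word v. Then X
· v has law π and lies in 𝒮 ∘ v, so π(x) differs from P(𝒮 ∘ wⁿ = {x}) by at most the probability
that wⁿ does not couple. As the sets are nested, the same holds for the event of stopping at {x}.
Letting n → ∞ gives `measure_stop_eq` for every stationary π, which includes uniqueness; existence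
is linear algebra. -/

instance instDiscreteMeasurableSpaceLetter (A : Type*) : DiscreteMeasurableSpace (Letter A) :=
  ⟨fun _ => trivial⟩

instance instDiscreteMeasurableSpaceWord (A : Type*) : DiscreteMeasurableSpace (Word A) :=
  ⟨fun _ => trivial⟩

/-- A word with exactly one letter `♯`, in last position. -/
def IsSharpWord (u : Word A) : Prop := ∃ l : List A, u = l.map some ++ [none]

theorem isSharpWord_singleton : IsSharpWord ([none] : Word A) := ⟨[], rfl⟩

theorem IsSharpWord.cons {u : Word A} (hu : IsSharpWord u) (a : A) : IsSharpWord (some a :: u) := by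
  obtain ⟨l, rfl⟩ := hu
  exact ⟨a :: l, rfl⟩

theorem blocks_sharp_append {b : Word A} (hb : IsSharpWord b) (v : Word A) :
    blocks (b ++ v) = b :: blocks v := by
  obtain ⟨l, rfl⟩ := hb
  induction l with
  | nil => rfl
  | cons a l ih =>
    simp only [List.map_cons, List.cons_append, blocks, ih]

theorem flatten_blocks (u : Word A) : (blocks u).flatten = u := by
  induction u with
  | nil => rfl
  | cons b u ih =>
    cases b with
    | none => simp [blocks, ih]
    | some a =>
      rw [blocks]
      split
      · next h => rw [h] at ih; simp at ih; simp [← ih]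
      · next h => rw [h] at ih; simp at ih; simp [ih]

/-! ### The law G_q and its weights -/

namespace MarkovAutomaton

variable (M : MarkovAutomaton S A) (q : Set.Ioc (0 : ℝ≥0) 1)

theorem delimDist_none : M.delimDist q none = ((q : ℝ≥0) : ℝ≥0∞) := rfl

theorem delimDist_some (a : A) :
    M.delimDist q (some a) = (1 - ((q : ℝ≥0) : ℝ≥0∞)) * M.dist a := rfl

/-- The weights of the distribution `G_q`. -/
def sharpWeight : Word A → ℝ≥0∞
  | [] => 0
  | [none] => M.delimDist q none
  | none :: _ :: _ => 0
  | some a :: u => M.delimDist q (some a) * sharpWeight u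

theorem isSharpWord_of_sharpWeight_ne_zero {u : Word A} (h : M.sharpWeight q u ≠ 0) :
    IsSharpWord u := by
  induction u with
  | nil => exact absurd rfl h
  | cons b u ih =>
    rcases b with _ | a
    · cases u with
      | nil => exact isSharpWord_singleton
      | cons => exact absurd rfl h
    · exact (ih (right_ne_zero_of_mul h)).cons a

theorem sharpWeight_of_isSharpWord {u : Word A} (hu : IsSharpWord u) :
    M.sharpWeight q u = (u.map (M.delimDist q)).prod := by
  obtain ⟨l, rfl⟩ := hu
  induction l with
  | nil => simp [sharpWeight]
  | cons a l ih =>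
    simp only [List.map_cons, List.cons_append, List.prod_cons, sharpWeight]
    rw [ih]

/-- Renewal equation of G_q: the first letter is ♯ and ends the word, or it is a letter of A
followed by a fresh G_q-word. -/
theorem tsum_sharpWeight_mul (φ : Word A → ℝ≥0∞) :
    ∑' u, M.sharpWeight q u * φ u = M.delimDist q none * φ [none] +
      ∑' a, M.delimDist q (some a) * ∑' u, M.sharpWeight q u * φ (some a :: u) := by
  rw [tsum_word, tsum_letter, show M.sharpWeight q [] = 0 from rfl, zero_mul, zero_add]
  congr 1
  · rw [tsum_eq_single []]
    · simp [sharpWeight]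
    · intro u hu
      cases u with
      | nil => exact absurd rfl hu
      | cons => simp [sharpWeight]
  · refine tsum_congr fun a => ?_
    simp only [sharpWeight, mul_assoc]
    rw [ENNReal.tsum_mul_left]

theorem truncate_eq_iff {u : Word A} (hu : IsSharpWord u) (s : ℕ → Letter A) :
    truncate s = u ↔ ∀ i < u.length, s i = u.getD i none := by
  obtain ⟨l, rfl⟩ := hu
  constructor
  · intro h i hi
    unfold truncate at h
    split at h
    · rw [← h] at hi ⊢
      have hi' : i < Nat.find ‹∃ i, s i = none› + 1 := by
        rwa [List.length_map, List.length_range] at hi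
      rw [List.getD_eq_getElem _ _ hi, List.getElem_map, List.getElem_range]
    · simp at h
  · intro h
    have hn : s l.length = none := by
      rw [h l.length (by simp)]
      simp
    have hs : ∀ i (hi : i < l.length), s i = some l[i] := by
      intro i hi
      rw [h i (by simp; omega)]
      simp [List.getD_eq_getElem?_getD, List.getElem?_append, hi]
    have hex : ∃ i, s i = none := ⟨_, hn⟩
    have hfind : Nat.find hex = l.length := by
      rw [Nat.find_eq_iff]
      exact ⟨hn, fun i hi => by simp [hs i hi]⟩
    unfold truncate
    rw [dif_pos hex, hfind]
    refine List.ext_getElem (by simp) fun i h1 h2 => ?_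
    simp only [List.length_map, List.length_range] at h1
    rcases Nat.lt_succ_iff_lt_or_eq.1 h1 with hi | rfl
    · simp [hs i hi, hi]
    · simp [hn]

theorem isSharpWord_truncate {s : ℕ → Letter A} (h : truncate s ≠ []) :
    IsSharpWord (truncate s) := by
  classical
  unfold truncate at h ⊢
  split at h
  · next hex =>
    rw [dif_pos hex]
    have hlt : ∀ i ∈ List.range (Nat.find hex), ∃ a, s i = some a := fun i hi =>
      Option.ne_none_iff_exists'.1 (Nat.find_min hex (List.mem_range.1 hi))
    have key : ∀ L : List ℕ, (∀ i ∈ L, ∃ a, s i = some a) →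
        ∃ l : List A, L.map s = l.map some := by
      intro L hL
      induction L with
      | nil => exact ⟨[], rfl⟩
      | cons i L ih =>
        obtain ⟨l, hl⟩ := ih fun j hj => hL j (by simp [hj])
        obtain ⟨a, ha⟩ := hL i (by simp)
        exact ⟨a :: l, by simp [ha, hl]⟩
    obtain ⟨l, hl⟩ := key _ hlt
    exact ⟨l, by rw [List.range_succ, List.map_append, hl]; simp [Nat.find_spec hex]⟩
  · exact absurd rfl h

theorem truncate_preimage_sharp {u : Word A} (hu : IsSharpWord u) :
    truncate ⁻¹' {u} =
      Set.pi (Finset.range u.length : Set ℕ) fun i => {u.getD i none} := by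
  ext s
  simp [truncate_eq_iff hu, Set.mem_pi]

theorem measurable_truncate [Countable A] : Measurable (truncate : (ℕ → Letter A) → Word A) := by
  have hsharp : ∀ u : Word A, IsSharpWord u →
      MeasurableSet ((truncate : (ℕ → Letter A) → Word A) ⁻¹' {u}) := by
    intro u hu
    rw [truncate_preimage_sharp hu]
    exact MeasurableSet.pi (Finset.countable_toSet _) fun _ _ => measurableSet_singleton _
  refine measurable_to_countable' fun u => ?_
  by_cases hu : u = []
  -- The fibre over the junk value `[]` is the complement of countably many cylinders.
  · have : (truncate : (ℕ → Letter A) → Word A) ⁻¹' {u} =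
        (⋃ v ∈ {v : Word A | IsSharpWord v}, truncate ⁻¹' {v})ᶜ := by
      ext s
      simp only [Set.mem_preimage, Set.mem_singleton_iff, Set.mem_ofPred_eq, Set.mem_compl_iff,
        Set.mem_iUnion, exists_prop, exists_eq_right', hu]
      refine ⟨?_, fun h => by_contra fun h' => h (isSharpWord_truncate h')⟩
      rintro h ⟨l, hl⟩
      rw [h] at hl
      simp at hl
    rw [this]
    exact (MeasurableSet.biUnion (Set.to_countable _) fun v hv => hsharp v hv).compl
  · by_cases h : IsSharpWord u
    · exact hsharp u h
    · convert MeasurableSet.empty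
      ext s
      simp only [Set.mem_preimage, Set.mem_singleton_iff, Set.mem_empty_iff_false, iff_false]
      rintro rfl
      exact h (isSharpWord_truncate hu)

theorem prod_range_getD (φ : Letter A → ℝ≥0∞) (u : Word A) :
    ∏ i ∈ Finset.range u.length, φ (u.getD i none) = (u.map φ).prod := by
  induction u with
  | nil => simp
  | cons b u ih =>
    rw [List.length_cons, Finset.prod_range_succ']
    simp only [List.getD_cons_succ, List.getD_cons_zero, List.map_cons, List.prod_cons]
    rw [ih, mul_comm]

theorem sharpWordLaw_of_isSharpWord [Countable A] {u : Word A} (hu : IsSharpWord u) :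
    M.sharpWordLaw q {u} = M.sharpWeight q u := by
  rw [sharpWordLaw, Measure.map_apply measurable_truncate (measurableSet_singleton _),
    truncate_preimage_sharp hu, Measure.infinitePi_pi _ (fun _ _ => measurableSet_singleton _)]
  simp only [PMF.toMeasure_apply_singleton _ _ (measurableSet_singleton _)]
  rw [prod_range_getD, sharpWeight_of_isSharpWord M q hu]

instance isProbabilityMeasure_sharpWordLaw [Countable A] :
    IsProbabilityMeasure (M.sharpWordLaw q) :=
  Measure.isProbabilityMeasure_map measurable_truncate.aemeasurable

theorem sharpWeight_le [Countable A] (u : Word A) : M.sharpWeight q u ≤ M.sharpWordLaw q {u} := by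
  by_cases hu : M.sharpWeight q u = 0
  · simp [hu]
  · rw [sharpWordLaw_of_isSharpWord M q (isSharpWord_of_sharpWeight_ne_zero M q hu)]

theorem tsum_sharpWordLaw_singleton [Countable A] : ∑' u, M.sharpWordLaw q {u} = 1 := by
  have h := lintegral_countable' (μ := M.sharpWordLaw q) (fun _ => 1)
  simpa using h.symm

theorem tsum_sharpWeight [Countable A] : ∑' u, M.sharpWeight q u = 1 := by
  have hle : ∑' u, M.sharpWeight q u ≤ 1 :=
    (ENNReal.tsum_le_tsum (M.sharpWeight_le q)).trans_eq (M.tsum_sharpWordLaw_singleton q)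
  -- The total mass T solves T = q + (1 - q) T. Comparison with the probability measure
  -- `sharpWordLaw` is needed only for T < ∞, which allows cancellation.
  have hrec := M.tsum_sharpWeight_mul q fun _ => 1
  simp only [mul_one] at hrec
  rw [ENNReal.tsum_mul_right] at hrec
  have hsum : M.delimDist q none + ∑' a, M.delimDist q (some a) = 1 := by
    rw [← tsum_letter, PMF.tsum_coe]
  have hq : M.delimDist q none ≠ 0 := by
    rw [delimDist_none]
    exact_mod_cast q.2.1.ne'
  have hT : ∑' u, M.sharpWeight q u ≠ ∞ := ne_top_of_le_ne_top ENNReal.one_ne_top hle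
  generalize ∑' u, M.sharpWeight q u = T at *
  generalize M.delimDist q none = x at *
  generalize ∑' a, M.delimDist q (some a) = y at *
  have hx : x ≠ ∞ := ne_top_of_le_ne_top ENNReal.one_ne_top (hsum ▸ le_self_add)
  have hy : y ≠ ∞ := ne_top_of_le_ne_top ENNReal.one_ne_top (hsum ▸ le_add_self)
  have h1 : x * T + y * T = x + y * T := by rw [← add_mul, hsum, one_mul]; exact hrec
  have h2 : x * T = x * 1 := by
    rw [mul_one]
    exact (ENNReal.add_left_inj (ENNReal.mul_ne_top hy hT)).1 h1
  exact (ENNReal.mul_right_inj hq hx).1 h2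

/-- The distribution `G_q` as a probability mass function. -/
def sharpPMF [Countable A] : PMF (Word A) :=
  ⟨M.sharpWeight q, M.tsum_sharpWeight q ▸ ENNReal.summable.hasSum⟩

theorem sharpPMF_apply [Countable A] (u : Word A) : M.sharpPMF q u = M.sharpWeight q u := rfl

theorem sharpWordLaw_singleton [Countable A] (u : Word A) :
    M.sharpWordLaw q {u} = M.sharpPMF q u := by
  -- A pointwise inequality between two families of total mass 1 cannot be strict anywhere; in
  -- particular infinite words without ♯ are negligible.
  refine (eq_of_le_of_not_lt (M.sharpWeight_le q u) fun hlt => ?_).symm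
  refine (ENNReal.tsum_lt_tsum ?_ (M.sharpWeight_le q) hlt).ne ?_
  · rw [tsum_sharpWeight]
    exact ENNReal.one_ne_top
  · rw [tsum_sharpWeight, tsum_sharpWordLaw_singleton]

end MarkovAutomaton

/-! ### Contraction and expansion preserve the bounding chain -/

namespace BoundingChain

variable {M : MarkovAutomaton S A} (C : BoundingChain M)

theorem read_append (h u : Word A) : C.read (h ++ u) = u.foldl C.step (C.read h) :=
  List.foldl_append

theorem read_concat (h : Word A) (b : Letter A) :
    C.read (h ++ [b]) = C.step (C.read h) b := by
  rw [read_append]; rfl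

theorem active_congr {h h' : Word A} (hh : C.read h = C.read h') : C.active h = C.active h' := by
  simp [active, hh]

/-- A history matters only through the set it leads to, so contracted and uncontracted histories are
interchangeable. -/
theorem contract_congr {h h' : Word A} (hh : C.read h = C.read h') (u : Word A) :
    C.contract h u = C.contract h' u := by
  induction u generalizing h h' with
  | nil => rfl
  | cons b u ih =>
    have hact := C.active_congr hh
    simp only [contract]
    rw [ih (h := h ++ [b]) (h' := h' ++ [b]) (by rw [read_concat, read_concat, hh]), ih hh]
    by_cases hb : b ∈ C.active h
    · rw [if_pos hb, if_pos (hact ▸ hb)]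
    · rw [if_neg hb, if_neg (hact ▸ hb)]

theorem contract_append (h u v : Word A) :
    C.contract h (u ++ v) = C.contract h u ++ C.contract (h ++ u) v := by
  induction u generalizing h with
  | nil => simp [contract]
  | cons b u ih =>
    simp only [List.cons_append, contract]
    split_ifs with hb
    · rw [ih]; simp
    · rw [ih]
      congr 1
      apply C.contract_congr
      rw [C.read_append h u, C.read_append h, List.foldl_cons]
      congr 1
      by_contra hne
      exact hb (Or.inr fun h' => hne h'.symm)

theorem step_eq_of_notMem_active {h : Word A} {b : Letter A} (hb : b ∉ C.active h) :
    C.step (C.read h) b = C.read h :=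
  not_not.1 fun h' => hb (Or.inr h')

theorem read_append_contract (h u : Word A) : C.read (h ++ C.contract h u) = C.read (h ++ u) := by
  induction u generalizing h with
  | nil => rfl
  | cons b u ih =>
    simp only [contract]
    split_ifs with hb
    · have := ih (h ++ [b])
      simpa using this
    · rw [ih, read_append, read_append, List.foldl_cons, C.step_eq_of_notMem_active hb]

theorem read_contract (u : Word A) : C.read (C.contract [] u) = C.read u :=
  C.read_append_contract [] u

theorem isSharpWord_contract {u : Word A} (hu : IsSharpWord u) (h : Word A) :
    IsSharpWord (C.contract h u) := by
  obtain ⟨l, rfl⟩ := hu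
  induction l generalizing h with
  | nil => simpa [contract, active] using isSharpWord_singleton
  | cons a l ih =>
    simp only [List.map_cons, List.cons_append, contract]
    split_ifs
    · exact (ih _).cons a
    · exact ih _

theorem notMem_active_iff (h : Word A) (b : Letter A) : b ∉ C.active h ↔ b ∈ C.passive h := by
  simp [active, passive]

/-- Two histories are needed because blocks are expanded relative to the unexpanded past `h`,
whereas the output is read after the expanded past `h'`. -/
theorem read_append_of_expandWeight_ne_zero {q : Set.Ioc (0 : ℝ≥0) 1} {h h' u v : Word A}
    (hh : C.read h = C.read h') (hne : C.expandWeight q h u v ≠ 0) :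
    C.read (h' ++ v) = C.read (h ++ u) := by
  induction v generalizing h h' u with
  | nil =>
    cases u with
    | nil => simp [hh]
    | cons => exact absurd rfl hne
  | cons b v ih =>
    cases u with
    | nil => exact absurd rfl hne
    | cons a u =>
      rw [expandWeight] at hne
      by_cases h1 : b ∈ C.passive h ∧ C.expandWeight q h (a :: u) v ≠ 0
      · rw [← ih hh h1.2, read_append, read_append, List.foldl_cons]
        congr 1
        rw [← hh]
        exact h1.1.2
      · by_cases h2 : b = a ∧ C.expandWeight q (h ++ [a]) u v ≠ 0
        · obtain ⟨rfl, h2⟩ := h2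
          have := ih (h := h ++ [b]) (h' := h' ++ [b]) (by rw [read_concat, read_concat, hh]) h2
          simpa using this
        · exfalso
          apply hne
          rw [not_and, not_ne_iff] at h1 h2
          rw [add_eq_zero]
          constructor
          · split_ifs with hb
            · rw [h1 hb, mul_zero]
            · rfl
          · split_ifs with hb
            · rw [h2 hb, mul_zero]
            · rfl

theorem read_append_of_mem_support_expandBlocks {h h' : Word A} {bs : List (Word A)} {v : Word A}
    (hh : C.read h = C.read h') (hv : v ∈ (C.expandBlocks h bs).support) :
    C.read (h' ++ v) = C.read (h ++ bs.flatten) := by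
  induction bs generalizing h h' v with
  | nil =>
    simp only [expandBlocks, PMF.support_pure, Set.mem_singleton_iff] at hv
    simp [hv, hh]
  | cons b bs ih =>
    simp only [expandBlocks, PMF.mem_support_bind_iff, PMF.mem_support_map_iff] at hv
    obtain ⟨x, hx, y, hy, rfl⟩ := hv
    have h1 := C.read_append_of_expandWeight_ne_zero (h' := h') hh hx
    rw [← List.append_assoc, ih h1.symm hy]
    simp

theorem read_of_mem_support_gExpand {z v : Word A} (hv : v ∈ (C.gExpand z).support) :
    C.read v = C.read z := by
  have := C.read_append_of_mem_support_expandBlocks (h' := []) rfl hv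
  rwa [flatten_blocks] at this

end BoundingChain

theorem bind_congr_support {α β : Type*} (p : PMF α) {f g : α → PMF β}
    (h : ∀ x ∈ p.support, f x = g x) : p.bind f = p.bind g := by
  ext b
  rw [PMF.bind_apply, PMF.bind_apply]
  refine tsum_congr fun x => ?_
  by_cases hx : p x = 0
  · simp [hx]
  · rw [h x hx]

/-! ### Expansion inverts contraction in law -/

namespace BoundingChain

variable {M : MarkovAutomaton S A} (C : BoundingChain M)

theorem expandWeight_cons_nil (q : Set.Ioc (0 : ℝ≥0) 1) (h : Word A) (a : Letter A) (u : Word A) :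
    C.expandWeight q h (a :: u) [] = 0 := by
  rw [expandWeight]

theorem expandWeight_cons_passive (q : Set.Ioc (0 : ℝ≥0) 1) {h : Word A} {a b : Letter A}
    (ha : a ∈ C.active h) (hb : b ∈ C.passive h) (u v : Word A) :
    C.expandWeight q h (a :: u) (b :: v) = M.delimDist q b * C.expandWeight q h (a :: u) v := by
  have hab : b ≠ a := by
    rintro rfl
    exact (C.notMem_active_iff h b).2 hb ha
  rw [expandWeight, if_pos hb, if_neg hab, add_zero]

theorem expandWeight_cons_active_self (q : Set.Ioc (0 : ℝ≥0) 1) {h : Word A} {b : Letter A}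
    (hb : b ∈ C.active h) (u v : Word A) :
    C.expandWeight q h (b :: u) (b :: v) =
      (M.delimDist q).toOuterMeasure (C.active h) * C.expandWeight q (h ++ [b]) u v := by
  have hb' : b ∉ C.passive h := fun hp => (C.notMem_active_iff h b).2 hp hb
  rw [expandWeight, if_neg hb', if_pos rfl, zero_add]

theorem expandWeight_cons_active_of_ne (q : Set.Ioc (0 : ℝ≥0) 1) {h : Word A} {a b : Letter A}
    (hb : b ∈ C.active h) (hab : b ≠ a) (u v : Word A) :
    C.expandWeight q h (a :: u) (b :: v) = 0 := by
  have hb' : b ∉ C.passive h := fun hp => (C.notMem_active_iff h b).2 hp hb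
  rw [expandWeight, if_neg hb', if_neg hab, zero_add]

theorem none_mem_active (h : Word A) : none ∈ C.active h := Or.inl rfl

/-- Probability that an infinite word of letter law `D_q`, truncated after its first `♯`,
contracted and expanded, becomes `v`, if its first letter is active. -/
def reexpandActive (q : Set.Ioc (0 : ℝ≥0) 1) (h v : Word A) : ℝ≥0∞ :=
  M.delimDist q none * C.expandWeight q h [none] v +
    ∑' a, {a | some a ∈ C.active h}.indicator (fun a => M.delimDist q (some a) *
      ∑' u, M.sharpWeight q u *
        C.expandWeight q h (some a :: C.contract (h ++ [some a]) u) v) a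

theorem reexpandActive_cons_passive (q : Set.Ioc (0 : ℝ≥0) 1) {h : Word A} {b : Letter A}
    (hb : b ∈ C.passive h) (v : Word A) :
    C.reexpandActive q h (b :: v) = M.delimDist q b * C.reexpandActive q h v := by
  simp only [reexpandActive]
  rw [C.expandWeight_cons_passive q (C.none_mem_active h) hb, mul_add, ← ENNReal.tsum_mul_left,
    mul_left_comm]
  congr 1
  refine tsum_congr fun a => ?_
  by_cases ha : some a ∈ C.active h
  · simp only [Set.indicator_of_mem (show a ∈ {a | some a ∈ C.active h} from ha),
      C.expandWeight_cons_passive q ha hb, mul_left_comm _ (M.delimDist q b),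
      ENNReal.tsum_mul_left]
  · simp [ha]

theorem reexpandActive_cons_none (q : Set.Ioc (0 : ℝ≥0) 1) (h v : Word A) :
    C.reexpandActive q h (none :: v) =
      (M.delimDist q).toOuterMeasure (C.active h) * M.sharpWeight q (none :: v) := by
  simp only [reexpandActive]
  rw [ENNReal.tsum_eq_zero.2, add_zero, C.expandWeight_cons_active_self q (C.none_mem_active h)]
  · cases v <;> simp [expandWeight, MarkovAutomaton.sharpWeight, mul_comm]
  · intro a
    simp [C.expandWeight_cons_active_of_ne q (C.none_mem_active h) (Option.some_ne_none a).symm]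

theorem reexpandActive_cons_active (q : Set.Ioc (0 : ℝ≥0) 1) {h : Word A} {a : A}
    (ha : some a ∈ C.active h) (v : Word A) :
    C.reexpandActive q h (some a :: v) =
      (M.delimDist q).toOuterMeasure (C.active h) * (M.delimDist q (some a) *
        ∑' u, M.sharpWeight q u *
          C.expandWeight q (h ++ [some a]) (C.contract (h ++ [some a]) u) v) := by
  simp only [reexpandActive]
  rw [C.expandWeight_cons_active_of_ne q ha (Option.some_ne_none a), mul_zero, zero_add,
    tsum_eq_single a]
  · rw [Set.indicator_of_mem (show a ∈ {a | some a ∈ C.active h} from ha)]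
    simp only [C.expandWeight_cons_active_self q ha,
      mul_left_comm _ ((M.delimDist q).toOuterMeasure (C.active h)), ENNReal.tsum_mul_left]
  · intro b hb
    have : some a ≠ some b := fun h' => hb (Option.some_injective _ h').symm
    simp [C.expandWeight_cons_active_of_ne q ha this]

/-- A passive first letter is erased by contraction, and what follows is again a G_q-word with the
same history. Hence T = R + D_q(Pas) T, that is D_q(Act) T = R. -/
theorem tsum_reexpand_mul_active [Countable A] (q : Set.Ioc (0 : ℝ≥0) 1) (h v : Word A) :
    (M.delimDist q).toOuterMeasure (C.active h) *
      ∑' u, M.sharpWeight q u * C.expandWeight q h (C.contract h u) v =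
      C.reexpandActive q h v := by
  have hle : ∑' u, M.sharpWeight q u * C.expandWeight q h (C.contract h u) v ≤ 1 := by
    rw [← M.tsum_sharpWeight q]
    exact ENNReal.tsum_le_tsum fun u => mul_le_of_le_one_right'
      ((ENNReal.le_tsum v).trans (C.tsum_expandWeight_le q h _))
  have hrec : ∑' u, M.sharpWeight q u * C.expandWeight q h (C.contract h u) v =
      C.reexpandActive q h v + (M.delimDist q).toOuterMeasure (C.passive h) *
        ∑' u, M.sharpWeight q u * C.expandWeight q h (C.contract h u) v := by
    conv_lhs => rw [M.tsum_sharpWeight_mul]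
    rw [reexpandActive, add_assoc]
    congr 1
    · rw [contract, if_pos (C.none_mem_active h), contract]
    · rw [PMF.toOuterMeasure_apply, tsum_letter, Set.indicator_of_notMem, zero_add,
        ← ENNReal.tsum_mul_right, ← ENNReal.tsum_add]
      · refine tsum_congr fun a => ?_
        by_cases ha : some a ∈ C.active h
        · have hp : some a ∉ C.passive h := fun hp => (C.notMem_active_iff h _).2 hp ha
          simp [contract, ha, hp]
        · have hp := (C.notMem_active_iff h _).1 ha
          simp [contract, ha, hp]
      · exact fun hp => hp.1 rfl
  have hT := ne_top_of_le_ne_top ENNReal.one_ne_top hle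
  have hs := C.mass_active_add_passive q h
  generalize ∑' u, M.sharpWeight q u * C.expandWeight q h (C.contract h u) v = T at *
  generalize C.reexpandActive q h v = R at *
  generalize (M.delimDist q).toOuterMeasure (C.active h) = y at *
  generalize (M.delimDist q).toOuterMeasure (C.passive h) = x at *
  have hx : x ≠ ∞ := ne_top_of_le_ne_top ENNReal.one_ne_top (hs ▸ le_self_add)
  refine (ENNReal.add_left_inj (ENNReal.mul_ne_top hx hT)).1 ?_
  rw [← hrec, ← add_mul, add_comm, hs, one_mul]

/-- Expanding the contraction of a word of law `G_q` gives back a word of law `G_q`. -/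
theorem tsum_sharpWeight_mul_expandWeight_contract [Countable A] (q : Set.Ioc (0 : ℝ≥0) 1)
    (h v : Word A) :
    ∑' u, M.sharpWeight q u * C.expandWeight q h (C.contract h u) v = M.sharpWeight q v := by
  have hy0 := C.mass_active_pos q h
  have hy : (M.delimDist q).toOuterMeasure (C.active h) ≠ ∞ :=
    ne_top_of_le_ne_top ENNReal.one_ne_top (C.mass_active_add_passive q h ▸ le_add_self)
  refine (ENNReal.mul_right_inj hy0 hy).1 ?_
  rw [tsum_reexpand_mul_active]
  -- The goal is now `reexpandActive` = D_q(Act_h) G_q(v). Peeling the first letter b of v yields a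
  -- factor D_q(b) in either case: a passive b is produced by the expansion itself, an active b must
  -- be the first letter of the word being expanded.
  induction v generalizing h with
  | nil => simp [reexpandActive, expandWeight_cons_nil, MarkovAutomaton.sharpWeight]
  | cons b v ih =>
    by_cases hb : b ∈ C.active h
    · rcases b with _ | a
      · rw [reexpandActive_cons_none]
      · rw [C.reexpandActive_cons_active q hb, MarkovAutomaton.sharpWeight]
        congr 2
        have hy0 := C.mass_active_pos q (h ++ [some a])
        have hy : (M.delimDist q).toOuterMeasure (C.active (h ++ [some a])) ≠ ∞ :=
          ne_top_of_le_ne_top ENNReal.one_ne_top (C.mass_active_add_passive q _ ▸ le_add_self)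
        refine (ENNReal.mul_right_inj hy0 hy).1 ?_
        rw [tsum_reexpand_mul_active, ih _ hy0 hy]
    · have hp := (C.notMem_active_iff h b).1 hb
      rw [C.reexpandActive_cons_passive q hp, ih h hy0 hy, mul_left_comm]
      congr 1
      rcases b with _ | a
      · exact absurd rfl hp.1
      · rw [MarkovAutomaton.sharpWeight]

theorem sharpPMF_bind_expand_contract [Countable A] (q : Set.Ioc (0 : ℝ≥0) 1) (h : Word A) :
    ((M.sharpPMF q).bind fun u => C.expand q h (C.contract h u)) = M.sharpPMF q := by
  ext v
  rw [PMF.bind_apply]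
  exact C.tsum_sharpWeight_mul_expandWeight_contract q h v

end BoundingChain

/-! ### Concatenated past words -/

namespace MarkovAutomaton

variable (M : MarkovAutomaton S A) [Countable A]

/-- The law of the concatenation `uⁿ ⋯ u¹` of independent words with laws `G_{2^{-m}}`. -/
def pastLaw : ℕ → PMF (Word A)
  | 0 => PMF.pure []
  | n + 1 => (M.sharpPMF (halfPow (n + 1))).bind fun u => (pastLaw n).map fun v => u ++ v

end MarkovAutomaton

namespace BoundingChain

variable {M : MarkovAutomaton S A} (C : BoundingChain M) [Countable A]

/-- Contraction keeps every ♯; hence each block is re-expanded with the parameter with which it was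
drawn. -/
theorem length_blocks_contract_of_mem_support {n : ℕ} {w : Word A}
    (hw : w ∈ (M.pastLaw n).support) (h : Word A) : (blocks (C.contract h w)).length = n := by
  induction n generalizing h w with
  | zero =>
    simp only [MarkovAutomaton.pastLaw, PMF.support_pure, Set.mem_singleton_iff] at hw
    simp [hw, contract, blocks]
  | succ n ih =>
    simp only [MarkovAutomaton.pastLaw, PMF.mem_support_bind_iff, PMF.mem_support_map_iff] at hw
    obtain ⟨u, hu, v, hv, rfl⟩ := hw
    rw [contract_append, blocks_sharp_append
      (C.isSharpWord_contract (M.isSharpWord_of_sharpWeight_ne_zero _ hu) h), List.length_cons,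
      ih hv]

theorem pastLaw_bind_expandBlocks (n : ℕ) (h : Word A) :
    ((M.pastLaw n).bind fun w => C.expandBlocks h (blocks (C.contract h w))) = M.pastLaw n := by
  induction n generalizing h with
  | zero =>
    rw [MarkovAutomaton.pastLaw, PMF.pure_bind]
    simp [contract, blocks, expandBlocks]
  | succ n ih =>
    rw [MarkovAutomaton.pastLaw, PMF.bind_bind]
    have key : ∀ u ∈ (M.sharpPMF (halfPow (n + 1))).support,
        (((M.pastLaw n).map fun v => u ++ v).bind fun w =>
          C.expandBlocks h (blocks (C.contract h w))) =
        (C.expand (halfPow (n + 1)) h (C.contract h u)).bind fun x =>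
          (M.pastLaw n).map fun y => x ++ y := by
      intro u hu
      have hc := C.isSharpWord_contract (M.isSharpWord_of_sharpWeight_ne_zero _ hu) h
      rw [PMF.bind_map]
      have h1 : ∀ v ∈ (M.pastLaw n).support,
          C.expandBlocks h (blocks (C.contract h (u ++ v))) =
          (C.expand (halfPow (n + 1)) h (C.contract h u)).bind fun x =>
            (C.expandBlocks (h ++ C.contract h u)
              (blocks (C.contract (h ++ C.contract h u) v))).map fun y => x ++ y := by
        intro v hv
        rw [contract_append, blocks_sharp_append hc, expandBlocks,
          C.length_blocks_contract_of_mem_support hv,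
          C.contract_congr (C.read_append_contract h u).symm v]
      refine (bind_congr_support _ h1).trans ?_
      rw [PMF.bind_comm]
      congr 1
      funext x
      conv_rhs => rw [← ih (h ++ C.contract h u)]
      rw [PMF.map_bind]
    rw [bind_congr_support _ key, ← PMF.bind_bind, sharpPMF_bind_expand_contract]

/-- The `𝒢`-expansion of the contraction of `uⁿ ⋯ u¹` has the law of `uⁿ ⋯ u¹`. -/
theorem map_contract_pastLaw_bind_gExpand (n : ℕ) :
    ((M.pastLaw n).map (C.contract [])).bind C.gExpand = M.pastLaw n := by
  rw [PMF.bind_map]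
  exact C.pastLaw_bind_expandBlocks n []

end BoundingChain

/-! ### The law of wⁿ along a run -/

theorem measure_eq_tsum_preimage {Ω ι : Type*} [MeasurableSpace Ω] (P : Measure Ω)
    [MeasurableSpace ι] [Countable ι] [MeasurableSingletonClass ι] {X : Ω → ι} (hX : Measurable X)
    {E : Set Ω} (hE : MeasurableSet E) : P E = ∑' t, P (X ⁻¹' {t} ∩ E) := by
  have hdisj : Pairwise (Function.onFun Disjoint fun t => X ⁻¹' {t} ∩ E) := fun t t' htt =>
    (Disjoint.preimage X (Set.disjoint_singleton.2 htt)).mono Set.inter_subset_left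
      Set.inter_subset_left
  rw [← measure_iUnion hdisj fun t => (hX (measurableSet_singleton t)).inter hE,
    ← Set.iUnion_inter, ← Set.preimage_iUnion, Set.iUnion_of_singleton, Set.preimage_univ,
    Set.univ_inter]

namespace BoundingChain

variable {M : MarkovAutomaton S A} {C : BoundingChain M} [Countable A]
  {Ω : Type*} [MeasurableSpace Ω] {P : Measure Ω} {u e w : ℕ → Ω → Word A}

namespace IsRun

theorem measurable_w (hrun : C.IsRun P u e w) (n : ℕ) : Measurable (w n) := by
  cases n with
  | zero => rw [show w 0 = fun _ => [] from funext hrun.w_zero]; exact measurable_const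
  | succ n =>
    rw [show w (n + 1) = (fun p : Word A × Word A => C.contract [] (p.1 ++ p.2)) ∘
      fun ω => (u (n + 1) ω, e n ω) from funext fun ω => hrun.w_succ n ω]
    exact (Measurable.of_discrete (α := Word A × Word A)).comp ((hrun.measurable_u _).prodMk (hrun.measurable_e _))

theorem measurableSet_w (hrun : C.IsRun P u e w) (n : ℕ) (p : Word A → Prop) :
    MeasurableSet {ω | p (w n ω)} :=
  hrun.measurable_w n (MeasurableSet.of_discrete (s := {z | p z}))

theorem measurableSet_u (hrun : C.IsRun P u e w) (s : Finset ℕ) (x : ℕ → Word A) :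
    MeasurableSet {ω | ∀ i ∈ s, u i ω = x i} := by
  simp only [Set.ofPred_forall]
  exact Finset.measurableSet_biInter s fun i _ => hrun.measurable_u i (measurableSet_singleton _)

/-- Marginalizes `law_e`: the values of all earlier expansions, and of the words u^i with i outside
`s`, are summed out. -/
theorem law_e_finset (hrun : C.IsRun P u e w) (n : ℕ) (s : Finset ℕ) (x : ℕ → Word A)
    (z v : Word A) :
    P {ω | (∀ i ∈ s, u i ω = x i) ∧ w n ω = z ∧ e n ω = v} =
      P {ω | (∀ i ∈ s, u i ω = x i) ∧ w n ω = z} * C.gExpand z v := by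
  obtain ⟨k, hk⟩ : ∃ k, ∀ i ∈ s, i < k :=
    ⟨s.sup id + 1, fun i hi => Nat.lt_succ_of_le (Finset.le_sup (f := id) hi)⟩
  let X : Ω → (Fin k → Word A) × (Fin n → Word A) := fun ω => (fun i => u i ω, fun i => e i ω)
  have hX : Measurable X := (measurable_pi_lambda _ fun i => hrun.measurable_u _).prodMk
    (measurable_pi_lambda _ fun i => hrun.measurable_e _)
  have hw : MeasurableSet {ω | w n ω = z} := hrun.measurableSet_w n (· = z)
  have he : MeasurableSet {ω | e n ω = v} := hrun.measurable_e n (measurableSet_singleton v)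
  have hu := hrun.measurableSet_u s x
  rw [measure_eq_tsum_preimage P hX
      (E := {ω | (∀ i ∈ s, u i ω = x i) ∧ w n ω = z ∧ e n ω = v}) (hu.inter (hw.inter he)),
    measure_eq_tsum_preimage P hX
      (E := {ω | (∀ i ∈ s, u i ω = x i) ∧ w n ω = z}) (hu.inter hw), ← ENNReal.tsum_mul_right]
  refine tsum_congr fun t => ?_
  by_cases ht : ∀ i (hi : i ∈ s), t.1 ⟨i, hk i hi⟩ = x i
  · have key := hrun.law_e n k (fun i => if hi : i < k then t.1 ⟨i, hi⟩ else [])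
      (fun i => if hi : i < n then t.2 ⟨i, hi⟩ else []) z v
    have hiff : ∀ ω, ω ∈ X ⁻¹' {t} ↔
        (∀ i < k, u i ω = if hi : i < k then t.1 ⟨i, hi⟩ else []) ∧
        (∀ i < n, e i ω = if hi : i < n then t.2 ⟨i, hi⟩ else []) := by
      intro ω
      simp only [X, Set.mem_preimage, Set.mem_singleton_iff, Prod.ext_iff, funext_iff, Fin.forall_iff]
      refine and_congr (forall₂_congr fun i hi => ?_) (forall₂_congr fun i hi => ?_) <;> rw [dif_pos hi]
    have hs : ∀ ω, ω ∈ X ⁻¹' {t} → ∀ i ∈ s, u i ω = x i := by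
      intro ω hω i hi
      rw [← ht i hi, ← (show X ω = t from hω)]
    convert key using 2
    · ext ω
      have := hiff ω
      have := hs ω
      simp only [Set.mem_inter_iff, Set.mem_ofPred_eq] at *
      tauto
    · congr 1
      ext ω
      have := hiff ω
      have := hs ω
      simp only [Set.mem_inter_iff, Set.mem_ofPred_eq] at *
      tauto
  · have h1 : ∀ p : Ω → Prop, P (X ⁻¹' {t} ∩ {ω | (∀ i ∈ s, u i ω = x i) ∧ p ω}) = 0 := by
      intro p
      convert measure_empty (μ := P)
      refine Set.eq_empty_of_forall_notMem fun ω hω => ht fun i hi => ?_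
      rw [← hω.2.1 i hi, ← (show X ω = t from hω.1)]
    rw [h1 fun ω => w n ω = z ∧ e n ω = v, h1 fun ω => w n ω = z, zero_mul]

theorem measure_e_of_measure_w (hrun : C.IsRun P u e w) (n : ℕ) (s : Finset ℕ) (x : ℕ → Word A)
    (c : ℝ≥0∞)
    (hw : ∀ z, P {ω | (∀ i ∈ s, u i ω = x i) ∧ w n ω = z} =
      c * (M.pastLaw n).map (C.contract []) z) (v : Word A) :
    P {ω | (∀ i ∈ s, u i ω = x i) ∧ e n ω = v} = c * M.pastLaw n v := by
  have he : MeasurableSet {ω | e n ω = v} := hrun.measurable_e n (measurableSet_singleton v)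
  rw [measure_eq_tsum_preimage P (hrun.measurable_w n)
    (E := {ω | (∀ i ∈ s, u i ω = x i) ∧ e n ω = v}) ((hrun.measurableSet_u s x).inter he)]
  conv_rhs => rw [← C.map_contract_pastLaw_bind_gExpand n, PMF.bind_apply,
    ← ENNReal.tsum_mul_left]
  refine tsum_congr fun z => ?_
  rw [← mul_assoc, ← hw, ← hrun.law_e_finset]
  congr 1
  ext ω
  simp only [Set.mem_inter_iff, Set.mem_preimage, Set.mem_singleton_iff, Set.mem_ofPred_eq]
  tauto

/-- The word `wⁿ` is independent of the later words `u^m`, and has the law of `c^ε(uⁿ ⋯ u¹)`. -/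
theorem measure_future_inter_w (hrun : C.IsRun P u e w) (n : ℕ) (s : Finset ℕ)
    (hs : ∀ i ∈ s, n < i) (x : ℕ → Word A) (z : Word A) :
    P {ω | (∀ i ∈ s, u i ω = x i) ∧ w n ω = z} =
      (∏ i ∈ s, M.sharpPMF (halfPow i) (x i)) * (M.pastLaw n).map (C.contract []) z := by
  classical
  induction n generalizing s x z with
  | zero =>
    have hu : P {ω | ∀ i ∈ s, u i ω = x i} = ∏ i ∈ s, M.sharpPMF (halfPow i) (x i) := by
      have := hrun.indep_u.measure_inter_preimage_eq_mul s (sets := fun i => {x i})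
        fun i _ => measurableSet_singleton _
      simp only [Set.ofPred_forall]
      refine this.trans (Finset.prod_congr rfl fun i _ => ?_)
      rw [← Measure.map_apply (hrun.measurable_u i) (measurableSet_singleton _), hrun.law_u,
        MarkovAutomaton.sharpWordLaw_singleton]
    simp only [hrun.w_zero, MarkovAutomaton.pastLaw, PMF.pure_map, contract, PMF.pure_apply]
    by_cases hz : z = []
    · simp [hz, hu]
    · simp [hz, Ne.symm hz]
  | succ n ih =>
    have hn : n + 1 ∉ s := fun h => lt_irrefl _ (hs _ h)
    let X : Ω → Word A × Word A := fun ω => (u (n + 1) ω, e n ω)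
    have hX : Measurable X := (hrun.measurable_u _).prodMk (hrun.measurable_e _)
    rw [measure_eq_tsum_preimage P hX (E := {ω | (∀ i ∈ s, u i ω = x i) ∧ w (n + 1) ω = z})
      ((hrun.measurableSet_u s x).inter (hrun.measurableSet_w (n + 1) (· = z)))]
    have key : ∀ a v : Word A,
        P {ω | (∀ i ∈ s, u i ω = x i) ∧ u (n + 1) ω = a ∧ e n ω = v} =
          (∏ i ∈ s, M.sharpPMF (halfPow i) (x i)) *
            (M.sharpPMF (halfPow (n + 1)) a * M.pastLaw n v) := by
      intro a v
      have hupd : ∀ i ∈ s, Function.update x (n + 1) a i = x i := fun i hi =>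
        Function.update_of_ne (fun h => hn (by rwa [← h])) _ _
      -- At time n the word uⁿ⁺¹ still belongs to the future, so it joins the prescribed later words
      -- in the induction hypothesis.
      have h1 := hrun.measure_e_of_measure_w n (insert (n + 1) s) (Function.update x (n + 1) a) _
        (fun z => ih (insert (n + 1) s) (by
          intro i hi
          rcases Finset.mem_insert.1 hi with rfl | hi
          · exact Nat.lt_succ_self n
          · exact (Nat.lt_succ_self n).trans (hs i hi)) _ z) v
      rw [Finset.prod_insert hn, Function.update_self,
        Finset.prod_congr rfl fun i hi => by rw [hupd i hi]] at h1
      rw [← mul_assoc, mul_comm (∏ i ∈ s, _), ← h1]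
      congr 1
      ext ω
      simp only [Set.mem_ofPred_eq, Finset.forall_mem_insert, Function.update_self]
      have hiff : (∀ i ∈ s, u i ω = Function.update x (n + 1) a i) ↔ ∀ i ∈ s, u i ω = x i :=
        forall₂_congr fun i hi => by rw [hupd i hi]
      rw [hiff]
      tauto
    rw [MarkovAutomaton.pastLaw, PMF.map_bind, PMF.bind_apply, ENNReal.tsum_prod',
      ← ENNReal.tsum_mul_left]
    refine tsum_congr fun a => ?_
    rw [PMF.map_comp, PMF.map_apply, ← ENNReal.tsum_mul_left, ← ENNReal.tsum_mul_left]
    refine tsum_congr fun v => ?_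
    simp only [Function.comp_apply]
    by_cases hz : z = C.contract [] (a ++ v)
    · rw [if_pos hz, ← key]
      congr 1
      ext ω
      simp only [X, Set.mem_inter_iff, Set.mem_preimage, Set.mem_singleton_iff, Set.mem_ofPred_eq,
        Prod.mk.injEq]
      constructor
      · tauto
      · rintro ⟨h1, h2, h3⟩
        refine ⟨⟨h2, h3⟩, h1, ?_⟩
        rw [hrun.w_succ, h2, h3, hz]
    · rw [if_neg hz, mul_zero, mul_zero]
      convert measure_empty (μ := P)
      refine Set.eq_empty_of_forall_notMem fun ω hω => hz ?_
      obtain ⟨h1, h2, h3⟩ := hω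
      simp only [X, Set.mem_preimage, Set.mem_singleton_iff, Prod.mk.injEq] at h1
      rw [← h1.1, ← h1.2, ← hrun.w_succ]
      exact h3.symm

theorem measure_w (hrun : C.IsRun P u e w) (n : ℕ) (z : Word A) :
    P {ω | w n ω = z} = (M.pastLaw n).map (C.contract []) z := by
  simpa using hrun.measure_future_inter_w n ∅ (by simp) (fun _ => []) z

theorem map_w [IsProbabilityMeasure P] (hrun : C.IsRun P u e w) (n : ℕ) :
    P.map (w n) = ((M.pastLaw n).map (C.contract [])).toMeasure := by
  refine Measure.ext_of_singleton fun z => ?_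
  rw [Measure.map_apply (hrun.measurable_w n) (measurableSet_singleton z),
    PMF.toMeasure_apply_singleton _ _ (measurableSet_singleton z)]
  exact hrun.measure_w n z

/-- Probabilities of events depending on the set `𝒮 ∘ wⁿ`. -/
theorem measure_read_w (hrun : C.IsRun P u e w) [IsProbabilityMeasure P] (n : ℕ) (p : C.sets → Prop)
    [DecidablePred p] :
    P {ω | p (C.read (w n ω))} = ∑' v, M.pastLaw n v * if p (C.read v) then 1 else 0 := by
  have h1 := congrArg (fun μ => μ {z | p (C.read z)}) (hrun.map_w n)
  rw [Measure.map_apply (hrun.measurable_w n) MeasurableSet.of_discrete,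
    PMF.toMeasure_map_apply _ _ _ measurable_from_top MeasurableSet.of_discrete,
    PMF.toMeasure_apply _ MeasurableSet.of_discrete] at h1
  refine h1.trans (tsum_congr fun v => ?_)
  simp [Set.indicator_apply, C.read_contract]

theorem ae_read_e (hrun : C.IsRun P u e w) (n : ℕ) :
    ∀ᵐ ω ∂P, C.read (e n ω) = C.read (w n ω) := by
  have h : ∀ z v : Word A, ∀ᵐ ω ∂P, w n ω = z ∧ e n ω = v → C.read v = C.read z := by
    intro z v
    by_cases hv : v ∈ (C.gExpand z).support
    · exact Filter.Eventually.of_forall fun _ _ => C.read_of_mem_support_gExpand hv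
    · have h1 := hrun.law_e_finset n ∅ (fun _ => []) z v
      rw [(PMF.apply_eq_zero_iff _ _).2 hv, mul_zero] at h1
      simp only [Finset.notMem_empty, false_imp_iff, implies_true, true_and] at h1
      filter_upwards [measure_eq_zero_iff_ae_notMem.1 h1] with ω hω h2
      exact absurd h2 hω
  filter_upwards [ae_all_iff.2 fun z => ae_all_iff.2 (h z)] with ω hω
  exact hω _ _ ⟨rfl, rfl⟩

end IsRun

end BoundingChain

/-! ### Stationary distributions -/

theorem tsum_bind_mul {α β : Type*} (p : PMF α) (f : α → PMF β) (φ : β → ℝ≥0∞) :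
    ∑' b, (p.bind f) b * φ b = ∑' a, p a * ∑' b, f a b * φ b := by
  simp only [PMF.bind_apply, ← ENNReal.tsum_mul_right, ← ENNReal.tsum_mul_left, mul_assoc]
  exact ENNReal.tsum_comm

theorem tsum_map_mul {α β : Type*} (p : PMF α) (f : α → β) (φ : β → ℝ≥0∞) :
    ∑' b, (p.map f) b * φ b = ∑' a, p a * φ (f a) := by
  rw [← PMF.bind_pure_comp, tsum_bind_mul]
  refine tsum_congr fun a => ?_
  rw [tsum_eq_single (f a) fun b hb => by simp [PMF.pure_apply, hb]]
  simp [PMF.pure_apply]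

/-- Subtraction-free form of g a - f a ≤ ∑ (g - f). -/
theorem tsum_add_le_add_tsum {α : Type*} {f g : α → ℝ≥0∞} (h : f ≤ g) (a : α) :
    ∑' b, f b + g a ≤ f a + ∑' b, g b := by
  classical
  rw [← tsum_ite_eq a g, ← tsum_ite_eq a f, ← ENNReal.tsum_add, ← ENNReal.tsum_add]
  refine ENNReal.tsum_le_tsum fun b => ?_
  split_ifs
  · exact le_rfl
  · simpa using h b

theorem tsum_pmf_mul_le_one {α : Type*} (p : PMF α) {φ : α → ℝ≥0∞} (hφ : ∀ a, φ a ≤ 1) :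
    ∑' a, p a * φ a ≤ 1 :=
  (ENNReal.tsum_le_tsum fun a => mul_le_of_le_one_right' (hφ a)).trans_eq p.tsum_coe

namespace MarkovAutomaton

variable (M : MarkovAutomaton S A)

theorem tsum_pastLaw_succ_mul [Countable A] (n : ℕ) (φ : Word A → ℝ≥0∞) :
    ∑' v, M.pastLaw (n + 1) v * φ v =
      ∑' u, M.sharpPMF (halfPow (n + 1)) u * ∑' v, M.pastLaw n v * φ (u ++ v) := by
  rw [pastLaw, tsum_bind_mul]
  simp only [tsum_map_mul]

/-- The state reached from `x` by reading a word. -/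
def actWord (x : S) (u : Word A) : S := u.foldl (fun y l => l.elim y (M.act y)) x

theorem actWord_append (x : S) (u v : Word A) :
    M.actWord x (u ++ v) = M.actWord (M.actWord x u) v :=
  List.foldl_append

theorem IsStationary.tsum_mul {M : MarkovAutomaton S A} {π : PMF S} (hπ : M.IsStationary π)
    (φ : S → ℝ≥0∞) : ∑' x, π x * ∑' a, M.dist a * φ (M.act x a) = ∑' x, π x * φ x := by
  conv_rhs => rw [← hπ, tsum_bind_mul]
  simp only [trans, tsum_map_mul]

/-- The length of a G_q-word is independent of the state. By the renewal equation and stationarity,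
the left side T satisfies T = q ∑ π φ + (1 - q) T; the bound on `φ` makes T finite. -/
theorem IsStationary.tsum_sharpPMF_mul [Countable A] {M : MarkovAutomaton S A} {π : PMF S}
    (hπ : M.IsStationary π) (q : Set.Ioc (0 : ℝ≥0) 1) {φ : S → ℝ≥0∞} (hφ : ∀ x, φ x ≤ 1) :
    ∑' x, π x * ∑' u, M.sharpPMF q u * φ (M.actWord x u) = ∑' x, π x * φ x := by
  have hrec : ∀ x, ∑' u, M.sharpPMF q u * φ (M.actWord x u) =
      ((q : ℝ≥0) : ℝ≥0∞) * φ x + (1 - ((q : ℝ≥0) : ℝ≥0∞)) *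
        ∑' a, M.dist a * ∑' u, M.sharpPMF q u * φ (M.actWord (M.act x a) u) := by
    intro x
    simp only [sharpPMF_apply]
    rw [M.tsum_sharpWeight_mul, ← ENNReal.tsum_mul_left]
    simp only [delimDist_none, delimDist_some, mul_assoc]
    rfl
  have hT : ∑' x, π x * ∑' u, M.sharpPMF q u * φ (M.actWord x u) ≤ 1 :=
    tsum_pmf_mul_le_one π fun x => tsum_pmf_mul_le_one _ fun u => hφ _
  have hT' := ne_top_of_le_ne_top ENNReal.one_ne_top hT
  have hsum : ∑' x, π x * ∑' u, M.sharpPMF q u * φ (M.actWord x u) =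
      ((q : ℝ≥0) : ℝ≥0∞) * (∑' x, π x * φ x) + (1 - ((q : ℝ≥0) : ℝ≥0∞)) *
        ∑' x, π x * ∑' u, M.sharpPMF q u * φ (M.actWord x u) := by
    conv_lhs => enter [1, x]; rw [hrec x]
    rw [← hπ.tsum_mul fun y => ∑' u, M.sharpPMF q u * φ (M.actWord y u), ← ENNReal.tsum_mul_left,
      ← ENNReal.tsum_mul_left, ← ENNReal.tsum_add]
    refine tsum_congr fun x => ?_
    rw [mul_add, mul_left_comm, mul_left_comm (π x)]
  have hq0 : ((q : ℝ≥0) : ℝ≥0∞) ≠ 0 := by exact_mod_cast q.2.1.ne'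
  have hq1 : ((q : ℝ≥0) : ℝ≥0∞) + (1 - ((q : ℝ≥0) : ℝ≥0∞)) = 1 :=
    add_tsub_cancel_of_le (by exact_mod_cast q.2.2)
  generalize ∑' x, π x * ∑' u, M.sharpPMF q u * φ (M.actWord x u) = T at *
  refine (ENNReal.mul_right_inj hq0 ENNReal.coe_ne_top).1
    ((ENNReal.add_left_inj (ENNReal.mul_ne_top
      (ENNReal.sub_ne_top ENNReal.one_ne_top (b := ((q : ℝ≥0) : ℝ≥0∞))) hT')).1 ?_)
  rw [← add_mul, hq1, one_mul]
  exact hsum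

theorem IsStationary.tsum_pastLaw_mul [Countable A] {M : MarkovAutomaton S A} {π : PMF S}
    (hπ : M.IsStationary π) (n : ℕ) {φ : S → ℝ≥0∞} (hφ : ∀ x, φ x ≤ 1) :
    ∑' x, π x * ∑' v, M.pastLaw n v * φ (M.actWord x v) = ∑' x, π x * φ x := by
  induction n with
  | zero =>
    refine tsum_congr fun x => ?_
    rw [pastLaw, tsum_eq_single [] fun v hv => by simp [PMF.pure_apply, hv]]
    simp [PMF.pure_apply, actWord]
  | succ n ih =>
    rw [← ih]
    simp only [tsum_pastLaw_succ_mul, actWord_append]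
    exact hπ.tsum_sharpPMF_mul _ (φ := fun y => ∑' v, M.pastLaw n v * φ (M.actWord y v))
      fun y => tsum_pmf_mul_le_one _ fun v => hφ _

/-- K - 1 kills the constants, so it has a left null vector v. The triangle inequality gives |v| ≤
|v| K entrywise, and both sides have the same total; hence |v| is invariant and can be normalized.
-/
theorem exists_isStationary [Finite S] [Nonempty S] : ∃ π : PMF S, M.IsStationary π := by
  classical
  cases nonempty_fintype S
  let K : Matrix S S ℝ := fun x y => (M.trans x y).toReal
  have hK0 : ∀ x y, 0 ≤ K x y := fun x y => ENNReal.toReal_nonneg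
  have hK1 : ∀ x, ∑ y, K x y = 1 := by
    intro x
    rw [← ENNReal.toReal_sum fun y _ => PMF.apply_ne_top _ _, ← tsum_fintype (L := .unconditional S),
      PMF.tsum_coe, ENNReal.toReal_one]
  have hdet : (K - 1).det = 0 := by
    refine Matrix.exists_mulVec_eq_zero_iff.1 ⟨fun _ => 1, ?_, ?_⟩
    · obtain ⟨x⟩ := ‹Nonempty S›
      exact fun h => one_ne_zero (congrFun h x)
    · ext x
      rw [Matrix.sub_mulVec, Matrix.one_mulVec]
      simp [Matrix.mulVec, dotProduct, hK1]
  obtain ⟨v, hv0, hv⟩ := Matrix.exists_vecMul_eq_zero_iff.2 hdet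
  have hvK : ∀ y, ∑ x, v x * K x y = v y := by
    intro y
    have := congrFun hv y
    rw [Matrix.vecMul_sub, Matrix.vecMul_one] at this
    exact sub_eq_zero.1 this
  have hle : ∀ y ∈ Finset.univ, |v y| ≤ ∑ x, |v x| * K x y := by
    intro y _
    conv_lhs => rw [← hvK y]
    refine (Finset.abs_sum_le_sum_abs _ _).trans_eq (Finset.sum_congr rfl fun x _ => ?_)
    rw [abs_mul, abs_of_nonneg (hK0 x y)]
  have hsum : ∑ y, |v y| = ∑ y, ∑ x, |v x| * K x y := by
    rw [Finset.sum_comm]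
    refine Finset.sum_congr rfl fun x _ => ?_
    rw [← Finset.mul_sum, hK1, mul_one]
  have heq := (Finset.sum_eq_sum_iff_of_le hle).1 hsum
  have hc : 0 < ∑ y, |v y| := by
    obtain ⟨y, hy⟩ := Function.ne_iff.1 hv0
    exact Finset.sum_pos' (fun _ _ => abs_nonneg _) ⟨y, Finset.mem_univ y, abs_pos.2 hy⟩
  obtain ⟨c, hcdef⟩ : ∃ c, c = ∑ y, |v y| := ⟨_, rfl⟩
  rw [← hcdef] at hc
  refine ⟨PMF.ofFintype (fun y => ENNReal.ofReal (|v y| * c⁻¹)) ?_, ?_⟩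
  · rw [← ENNReal.ofReal_sum_of_nonneg fun y _ => by positivity, ← Finset.sum_mul, ← hcdef,
      mul_inv_cancel₀ hc.ne', ENNReal.ofReal_one]
  · ext y
    have hy : ENNReal.ofReal (|v y| * c⁻¹) = ∑ x, ENNReal.ofReal (|v x| * K x y * c⁻¹) := by
      rw [← ENNReal.ofReal_sum_of_nonneg fun x _ => by have := hK0 x y; positivity,
        ← Finset.sum_mul, ← heq y (Finset.mem_univ y)]
    rw [PMF.bind_apply, tsum_fintype, PMF.ofFintype_apply, hy]
    refine Finset.sum_congr rfl fun x _ => ?_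
    have hKE : ENNReal.ofReal (K x y) = M.trans x y := ENNReal.ofReal_toReal (PMF.apply_ne_top _ _)
    rw [PMF.ofFintype_apply, mul_right_comm, ← hKE, ← ENNReal.ofReal_mul (by positivity)]

end MarkovAutomaton

/-! ### Probability of not coupling -/

namespace BoundingChain

variable {M : MarkovAutomaton S A} (C : BoundingChain M)

theorem actWord_mem_foldl (u : Word A) {x : S} {B : C.sets} (hx : x ∈ (B : Set S)) :
    M.actWord x u ∈ ((u.foldl C.step B : C.sets) : Set S) := by
  induction u generalizing x B with
  | nil => exact hx
  | cons b u ih =>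
    rcases b with _ | a
    · exact ih hx
    · exact ih (C.act_mem B a x hx)

theorem actWord_mem_read (u : Word A) (x : S) : M.actWord x u ∈ (C.read u : Set S) :=
  C.actWord_mem_foldl u (Set.mem_univ x)

variable {C}

theorem IsMonotone.foldl (hmono : C.IsMonotone) (u : Word A) {B B' : C.sets}
    (h : (B : Set S) ⊆ B') : ((u.foldl C.step B : C.sets) : Set S) ⊆ (u.foldl C.step B' : C.sets) := by
  induction u generalizing B B' with
  | nil => exact h
  | cons b u ih =>
    rcases b with _ | a
    · exact ih h
    · exact ih (hmono B B' a h)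

theorem IsMonotone.read_append_subset (hmono : C.IsMonotone) (u v : Word A) :
    (C.read (u ++ v) : Set S) ⊆ C.read v := by
  rw [read_append]
  exact hmono.foldl v (Set.subset_univ _)

theorem PreservesSingletons.foldl (hsing : C.PreservesSingletons) (u : Word A) {B : C.sets} {x : S}
    (h : (B : Set S) = {x}) : ((u.foldl C.step B : C.sets) : Set S) = {M.actWord x u} := by
  induction u generalizing B x with
  | nil => exact h
  | cons b u ih =>
    rcases b with _ | a
    · exact ih h
    · exact ih (hsing B a x h)

theorem Couples.append_right {u : Word A} (hu : C.Couples u) (hsing : C.PreservesSingletons)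
    (v : Word A) : C.Couples (u ++ v) := by
  obtain ⟨x, hx⟩ := hu
  exact ⟨_, by rw [read_append]; exact hsing.foldl v hx⟩

theorem read_eq_singleton_of_subset {u : Word A} {x : S} (h : (C.read u : Set S) ⊆ {x}) :
    (C.read u : Set S) = {x} :=
  (Set.Nonempty.subset_singleton_iff ⟨_, C.actWord_mem_read u x⟩).1 h

theorem Couples.append_left {v : Word A} (hv : C.Couples v) (hmono : C.IsMonotone) (u : Word A) :
    C.Couples (u ++ v) := by
  obtain ⟨x, hx⟩ := hv
  exact ⟨x, read_eq_singleton_of_subset (hx ▸ hmono.read_append_subset u v)⟩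

variable (C)

open Classical in
/-- The indicator of the words that do not couple. -/
def missInd (u : Word A) : ℝ≥0∞ := if C.Couples u then 0 else 1

variable {C} in
theorem missInd_of_couples {u : Word A} (hu : C.Couples u) : C.missInd u = 0 := if_pos hu

theorem missInd_le_one (u : Word A) : C.missInd u ≤ 1 := by
  unfold missInd
  split_ifs <;> simp

variable {C} in
theorem missInd_mono {u v : Word A} (h : C.Couples u → C.Couples v) :
    C.missInd v ≤ C.missInd u := by
  unfold missInd
  split_ifs <;> simp_all

/-- Probability that the word `h`, followed by a word of law `G_q`, does not couple. -/
def missProb (q : Set.Ioc (0 : ℝ≥0) 1) (h : Word A) : ℝ≥0∞ :=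
  ∑' u, M.sharpWeight q u * C.missInd (h ++ u)

theorem missProb_eq (q : Set.Ioc (0 : ℝ≥0) 1) (h : Word A) :
    C.missProb q h = M.delimDist q none * C.missInd (h ++ [none]) +
      ∑' a, M.delimDist q (some a) * C.missProb q (h ++ [some a]) := by
  simp only [missProb]
  rw [M.tsum_sharpWeight_mul]
  simp

variable {C}

theorem missProb_le_nil (hmono : C.IsMonotone) (q : Set.Ioc (0 : ℝ≥0) 1) (h : Word A) :
    C.missProb q h ≤ C.missProb q [] :=
  ENNReal.tsum_le_tsum fun _ => mul_le_mul_right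
    (missInd_mono fun hu => Couples.append_left hu hmono h) _

theorem missProb_le_one [Countable A] (q : Set.Ioc (0 : ℝ≥0) 1) (h : Word A) :
    C.missProb q h ≤ 1 :=
  tsum_pmf_mul_le_one (M.sharpPMF q) fun _ => C.missInd_le_one _

/-- With f = `missProb q` and F = f [], monotonicity gives f ≤ F after every history. Splitting on
the first letter yields f(h) ≤ q + F - D_q(a) (F - f(h a)), written without subtraction. -/
theorem missProb_add_le [Countable A] (hmono : C.IsMonotone) (q : Set.Ioc (0 : ℝ≥0) 1) (h : Word A)
    (a : A) :
    C.missProb q h + M.delimDist q (some a) * C.missProb q [] ≤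
      M.delimDist q none + C.missProb q [] +
        M.delimDist q (some a) * C.missProb q (h ++ [some a]) := by
  classical
  have hsum : M.delimDist q none + ∑' a, M.delimDist q (some a) = 1 := by
    rw [← tsum_letter, PMF.tsum_coe]
  have h1 : ∑' b, M.delimDist q (some b) * C.missProb q (h ++ [some b]) +
      M.delimDist q (some a) * C.missProb q [] ≤
      M.delimDist q (some a) * C.missProb q (h ++ [some a]) +
        ∑' b, M.delimDist q (some b) * C.missProb q [] :=
    tsum_add_le_add_tsum (f := fun b => M.delimDist q (some b) * C.missProb q (h ++ [some b]))
      (g := fun b => M.delimDist q (some b) * C.missProb q [])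
      (fun b => mul_le_mul_right (missProb_le_nil hmono q _) _) a
  have h2 : ∑' b, M.delimDist q (some b) * C.missProb q [] ≤ C.missProb q [] := by
    rw [ENNReal.tsum_mul_right]
    exact mul_le_of_le_one_left' (hsum ▸ le_add_self)
  rw [missProb_eq, add_assoc, add_assoc]
  refine add_le_add (mul_le_of_le_one_right' (C.missInd_le_one _)) (h1.trans ?_)
  rw [add_comm]
  gcongr

theorem missProb_add_prod_le [Countable A] (hmono : C.IsMonotone) (q : Set.Ioc (0 : ℝ≥0) 1)
    (v : List A) (h : Word A) :
    C.missProb q h + (v.map fun a => M.delimDist q (some a)).prod * C.missProb q [] ≤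
      v.length * M.delimDist q none + C.missProb q [] +
        (v.map fun a => M.delimDist q (some a)).prod * C.missProb q (h ++ v.map some) := by
  induction v generalizing h with
  | nil => simp [add_comm]
  | cons a v ih =>
    have hF : M.delimDist q (some a) * C.missProb q [] ≠ ∞ :=
      ENNReal.mul_ne_top (PMF.apply_ne_top _ _)
        (ne_top_of_le_ne_top ENNReal.one_ne_top (missProb_le_one q []))
    have h1 := missProb_add_le hmono q h a
    have h2 := mul_le_mul_right (ih (h ++ [some a])) (M.delimDist q (some a))
    have h3 : M.delimDist q (some a) * (v.length * M.delimDist q none) ≤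
        v.length * M.delimDist q none := mul_le_of_le_one_left' (PMF.coe_le_one _ _)
    simp only [List.map_cons, List.prod_cons, List.length_cons, List.append_assoc,
      List.cons_append, List.nil_append, mul_add, mul_assoc] at h2 ⊢
    push_cast
    generalize (v.map fun a => M.delimDist q (some a)).prod = Q at *
    generalize C.missProb q [] = F at *
    generalize C.missProb q (h ++ some a :: v.map some) = Z at *
    generalize C.missProb q (h ++ [some a]) = Y at *
    generalize C.missProb q h = X at *
    generalize M.delimDist q (some a) = d at *
    generalize M.delimDist q none = p at *
    -- Adding the finite term d F to both sides lets the one-step bound and the induction hypothesis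
    -- be chained in `ℝ≥0∞`.
    refine (ENNReal.add_le_add_iff_right hF).1 ?_
    calc X + d * (Q * F) + d * F = (X + d * F) + d * (Q * F) := by ring
      _ ≤ (p + F + d * Y) + d * (Q * F) := by gcongr
      _ = p + F + (d * Y + d * (Q * F)) := by ring
      _ ≤ p + F + (d * (v.length * p) + d * F + d * (Q * Z)) := by gcongr
      _ ≤ p + F + (v.length * p + d * F + d * (Q * Z)) := by gcongr
      _ = (v.length + 1) * p + F + d * (Q * Z) + d * F := by ring

/-- The one-step bound iterated along `v` from the empty history has F on both sides, and f vanishes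
after `v` because singletons stay singletons. -/
theorem prod_mul_missProb_le [Countable A] (hmono : C.IsMonotone) (hsing : C.PreservesSingletons)
    (q : Set.Ioc (0 : ℝ≥0) 1) {v : List A} (hv : C.Couples (v.map some)) :
    (v.map fun a => M.delimDist q (some a)).prod * C.missProb q [] ≤
      v.length * M.delimDist q none := by
  have h1 := missProb_add_prod_le hmono q v []
  have h2 : C.missProb q ([] ++ v.map some) = 0 :=
    ENNReal.tsum_eq_zero.2 fun u => by
      rw [List.nil_append, missInd_of_couples (hv.append_right hsing u), mul_zero]
  rw [h2, mul_zero, add_zero, add_comm] at h1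
  exact (ENNReal.add_le_add_iff_right
    (ne_top_of_le_ne_top ENNReal.one_ne_top (missProb_le_one q []))).1 h1

/-- The newest word uⁿ⁺¹ is read first; if it couples, so does the whole concatenation. -/
theorem tsum_pastLaw_missInd_le [Countable A] (hsing : C.PreservesSingletons) (n : ℕ) :
    ∑' v, M.pastLaw (n + 1) v * C.missInd v ≤ C.missProb (halfPow (n + 1)) [] := by
  rw [M.tsum_pastLaw_succ_mul]
  refine ENNReal.tsum_le_tsum fun u => mul_le_mul_right ?_ _
  refine (ENNReal.tsum_le_tsum fun v => mul_le_mul_right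
    (missInd_mono (v := u ++ v) fun hu => Couples.append_right hu hsing v) _).trans_eq ?_
  rw [ENNReal.tsum_mul_right, PMF.tsum_coe, one_mul, List.nil_append]

theorem delimDist_halfPow_some_ge (M : MarkovAutomaton S A) (n : ℕ) (a : A) :
    2⁻¹ * M.dist a ≤ M.delimDist (halfPow (n + 1)) (some a) := by
  rw [MarkovAutomaton.delimDist_some]
  gcongr
  rw [← ENNReal.one_sub_inv_two]
  gcongr
  simp only [halfPow]
  rw [ENNReal.coe_pow, ENNReal.coe_inv two_ne_zero, ENNReal.coe_ofNat]
  exact pow_le_of_le_one zero_le (ENNReal.inv_le_one.2 one_le_two) n.succ_ne_zero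

theorem tsum_missProb_halfPow_lt_top [Countable A] (hmono : C.IsMonotone)
    (hsing : C.PreservesSingletons) {v : List A} (hv : C.Couples (v.map some)) :
    ∑' n, C.missProb (halfPow (n + 1)) [] < ∞ := by
  let Q : ℝ≥0∞ := (v.map fun a => 2⁻¹ * M.dist a).prod
  -- `Q` bounds from below, uniformly in n, the probability of the letters of `v`, since 1 -
  -- 2^{-(n+1)} ≥ 1/2.
  have hQ0 : Q ≠ 0 := by
    refine List.prod_ne_zero fun h => ?_
    obtain ⟨a, _, ha⟩ := List.mem_map.1 h
    exact mul_ne_zero (ENNReal.inv_ne_zero.2 ENNReal.ofNat_ne_top) (M.dist_pos a).ne' ha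
  have hle : Q * ∑' n, C.missProb (halfPow (n + 1)) [] ≤ v.length := by
    rw [← ENNReal.tsum_mul_left]
    have hn : ∀ n, Q * C.missProb (halfPow (n + 1)) [] ≤ v.length * 2⁻¹ ^ (n + 1) := by
      intro n
      have h1 := prod_mul_missProb_le hmono hsing (halfPow (n + 1)) hv
      have h2 : M.delimDist (halfPow (n + 1)) none = 2⁻¹ ^ (n + 1) := by
        rw [MarkovAutomaton.delimDist_none]
        simp only [halfPow]
        rw [ENNReal.coe_pow, ENNReal.coe_inv two_ne_zero, ENNReal.coe_ofNat]
      rw [h2] at h1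
      refine le_trans (mul_le_mul_left ?_ _) h1
      exact List.Forall₂.prod_le_prod' (List.forall₂_map_left_iff.2 (List.forall₂_map_right_iff.2
        (List.forall₂_same.2 fun a _ => delimDist_halfPow_some_ge M n a)))
    refine (ENNReal.tsum_le_tsum hn).trans_eq ?_
    rw [ENNReal.tsum_mul_left, ENNReal.tsum_geometric_add_one, ENNReal.one_sub_inv_two, inv_inv,
      ENNReal.inv_mul_cancel two_ne_zero ENNReal.ofNat_ne_top, mul_one]
  refine lt_top_iff_ne_top.2 fun h => ?_
  rw [h, ENNReal.mul_top hQ0] at hle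
  exact absurd hle (by simp)

end BoundingChain

/-! ### The stopping time and the law of the output -/

namespace BoundingChain

variable {M : MarkovAutomaton S A} {C : BoundingChain M}
  {Ω : Type*} {u e w : ℕ → Ω → Word A}

theorem firstCoupling_le {ω : Ω} {n : ℕ} (h : C.Couples (w n ω)) : C.firstCoupling w ω ≤ n :=
  iInf₂_le n h

theorem exists_couples_of_firstCoupling_eq {ω : Ω} {n : ℕ} (h : C.firstCoupling w ω = n) :
    C.Couples (w n ω) := by
  have hne : {n : ℕ | C.Couples (w n ω)}.Nonempty := by
    by_contra hempty
    rw [Set.not_nonempty_iff_eq_empty] at hempty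
    simp only [firstCoupling, hempty, Set.mem_empty_iff_false, iInf_false, iInf_top] at h
    exact ENat.top_ne_natCast n h
  have h1 : C.firstCoupling w ω = ((sInf {n : ℕ | C.Couples (w n ω)} : ℕ) : ℕ∞) := by
    refine le_antisymm (firstCoupling_le (Nat.sInf_mem hne)) (le_iInf₂ fun m hm => ?_)
    exact_mod_cast Nat.sInf_le hm
  rw [h1, ENat.natCast_inj] at h
  exact h ▸ Nat.sInf_mem hne

/-- Every index before N is a miss, so N is at most the number of misses. This direction needs no
monotonicity. -/
theorem firstCoupling_le_tsum (ω : Ω) :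
    (C.firstCoupling w ω : ℝ≥0∞) ≤ ∑' n, C.missInd (w n ω) := by
  have hfin : ∀ k : ℕ, (k : ℕ∞) ≤ C.firstCoupling w ω →
      (k : ℝ≥0∞) ≤ ∑' n, C.missInd (w n ω) := by
    intro k hk
    refine le_trans ?_ (ENNReal.sum_le_tsum (Finset.range k))
    have : ∀ n ∈ Finset.range k, C.missInd (w n ω) = 1 := by
      intro n hn
      refine if_neg fun hc => ?_
      have h1 := hk.trans (firstCoupling_le hc)
      exact absurd (Finset.mem_range.1 hn) (not_lt.2 (by exact_mod_cast h1))
    rw [Finset.sum_congr rfl this]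
    simp
  generalize C.firstCoupling w ω = N at *
  induction N with
  | top =>
    rw [ENNReal.eq_top_of_forall_nnreal_le (x := ∑' n, C.missInd (w n ω)) fun r => ?_]
    · exact le_top
    · obtain ⟨k, hk⟩ := exists_nat_ge r
      exact le_trans (by exact_mod_cast hk) (hfin k le_top)
  | coe n => exact_mod_cast hfin n le_rfl

namespace IsRun

variable [Countable A] [MeasurableSpace Ω] {P : Measure Ω}

theorem lintegral_missInd [IsProbabilityMeasure P] (hrun : C.IsRun P u e w) (n : ℕ) :
    ∫⁻ ω, C.missInd (w n ω) ∂P = ∑' v, M.pastLaw n v * C.missInd v := by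
  classical
  have h := hrun.measure_read_w n fun B => ¬ ∃ x, (B : Set S) = {x}
  have hind : ∀ ω, C.missInd (w n ω) =
      {ω | ¬ ∃ x, (C.read (w n ω) : Set S) = {x}}.indicator 1 ω := by
    intro ω
    unfold missInd Couples
    by_cases hc : ∃ x, (C.read (w n ω) : Set S) = {x}
    · rw [if_pos hc, Set.indicator_of_notMem (by exact fun h => h hc)]
    · rw [if_neg hc, Set.indicator_of_mem (by exact hc), Pi.one_apply]
  simp only [hind]
  rw [lintegral_indicator_one
    (hrun.measurableSet_w n fun z => ¬ ∃ x, (C.read z : Set S) = {x}), h]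
  refine tsum_congr fun v => ?_
  unfold missInd Couples
  congr 1
  split_ifs <;> simp_all

theorem measurable_missInd (hrun : C.IsRun P u e w) (n : ℕ) :
    Measurable fun ω => C.missInd (w n ω) :=
  (Measurable.of_discrete (f := C.missInd)).comp (hrun.measurable_w n)

theorem tsum_missInd_lt_top [IsProbabilityMeasure P] (hrun : C.IsRun P u e w)
    (hmono : C.IsMonotone) (hsing : C.PreservesSingletons) {v : List A}
    (hv : C.Couples (v.map some)) : ∑' n, ∫⁻ ω, C.missInd (w n ω) ∂P < ∞ := by
  -- The term n = 0 is bounded by 1, as the empty word contains no G-word to apply the estimate to.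
  rw [tsum_eq_zero_add' ENNReal.summable, ENNReal.add_lt_top]
  constructor
  · rw [hrun.lintegral_missInd]
    exact (tsum_pmf_mul_le_one _ fun _ => C.missInd_le_one _).trans_lt ENNReal.one_lt_top
  · refine (ENNReal.tsum_le_tsum fun n => ?_).trans_lt
      (tsum_missProb_halfPow_lt_top hmono hsing hv)
    rw [hrun.lintegral_missInd]
    exact tsum_pastLaw_missInd_le hsing n

theorem ae_read_subset (hrun : C.IsRun P u e w) (hmono : C.IsMonotone) :
    ∀ᵐ ω ∂P, ∀ m n, m ≤ n → (C.read (w n ω) : Set S) ⊆ C.read (w m ω) := by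
  filter_upwards [ae_all_iff.2 hrun.ae_read_e] with ω hω m n hmn
  induction n, hmn using Nat.le_induction with
  | base => exact subset_rfl
  | succ n hmn ih =>
    refine subset_trans ?_ ih
    rw [hrun.w_succ, read_contract, ← hω n]
    exact hmono.read_append_subset _ _

end IsRun

/-- A start of law π stays of law π after an independent past word, and it ends at `x` whenever the
bounding set is {x}. -/
theorem tsum_pastLaw_singleton_le [Countable A] {π : PMF S} (hπ : M.IsStationary π) (n : ℕ)
    (x : S) [DecidablePred fun B : C.sets => (B : Set S) = {x}] :
    ∑' v, M.pastLaw n v * (if (C.read v : Set S) = {x} then 1 else 0) ≤ π x := by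
  classical
  have h := hπ.tsum_pastLaw_mul n (φ := fun y => if y = x then 1 else 0) fun y => by
    split_ifs <;> simp
  have h1 : ∑' y, π y * (if y = x then 1 else 0) = π x := by
    simp
  rw [h1] at h
  rw [← h, ← one_mul (∑' v, _), ← π.tsum_coe, ← ENNReal.tsum_mul_right]
  refine ENNReal.tsum_le_tsum fun y => mul_le_mul_right
    (ENNReal.tsum_le_tsum fun v => mul_le_mul_right ?_ _) _
  by_cases hv : (C.read v : Set S) = {x}
  · have : M.actWord y v = x := by simpa [hv] using C.actWord_mem_read v y
    rw [if_pos this]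
    split_ifs
    simp
  · simp [hv]

/-- If a stationary start ends at `x`, the bounding set is either {x} or not a singleton. -/
theorem le_tsum_pastLaw_singleton_add [Countable A] {π : PMF S} (hπ : M.IsStationary π) (n : ℕ)
    (x : S) [DecidablePred fun B : C.sets => (B : Set S) = {x}] :
    π x ≤ ∑' v, M.pastLaw n v * (if (C.read v : Set S) = {x} then 1 else 0) +
      ∑' v, M.pastLaw n v * C.missInd v := by
  classical
  have h := hπ.tsum_pastLaw_mul n (φ := fun y => if y = x then 1 else 0) fun y => by
    split_ifs <;> simp
  have h1 : ∑' y, π y * (if y = x then 1 else 0) = π x := by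
    simp
  rw [h1] at h
  rw [← h, ← one_mul (∑' v, _ + _), ← π.tsum_coe, ← ENNReal.tsum_mul_right, ← ENNReal.tsum_add]
  refine ENNReal.tsum_le_tsum fun y => mul_le_mul_right
    (ENNReal.tsum_le_tsum fun v => ?_) _
  rw [← mul_add]
  refine mul_le_mul_right ?_ _
  by_cases hv : C.Couples v
  · obtain ⟨z, hz⟩ := hv
    have : M.actWord y v = z := by simpa [hz] using C.actWord_mem_read v y
    subst this
    by_cases hx : M.actWord y v = x <;> simp [hz, hx]
  · have : C.missInd v = 1 := if_neg hv
    rw [this]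
    split_ifs <;> simp

/-- The event that the run stops at the singleton `{x}` has probability `π x`, for any stationary
distribution `π`. -/
theorem IsRun.measure_stop_eq [Countable A] [MeasurableSpace Ω] {P : Measure Ω}
    [IsProbabilityMeasure P] (hrun : C.IsRun P u e w)
    (hmono : C.IsMonotone) (hsing : C.PreservesSingletons) {v : List A}
    (hv : C.Couples (v.map some)) {π : PMF S} (hπ : M.IsStationary π) (x : S) :
    P {ω | ∃ n : ℕ, C.firstCoupling w ω = n ∧ (C.read (w n ω) : Set S) = {x}} = π x := by
  classical
  set E := {ω | ∃ n : ℕ, C.firstCoupling w ω = n ∧ (C.read (w n ω) : Set S) = {x}}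
  let miss : ℕ → ℝ≥0∞ := fun n => ∫⁻ ω, C.missInd (w n ω) ∂P
  have hmiss : Filter.Tendsto miss Filter.atTop (nhds 0) :=
    ENNReal.tendsto_atTop_zero_of_tsum_ne_top (hrun.tsum_missInd_lt_top hmono hsing hv).ne
  have hpast : ∀ n, P {ω | (C.read (w n ω) : Set S) = {x}} =
      ∑' v, M.pastLaw n v * (if (C.read v : Set S) = {x} then 1 else 0) := fun n =>
    hrun.measure_read_w n fun B => (B : Set S) = {x}
  have hnot : ∀ n, P {ω | ¬ C.Couples (w n ω)} = miss n := by
    intro n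
    rw [← lintegral_indicator_one (hrun.measurableSet_w n fun z => ¬ C.Couples z)]
    refine lintegral_congr fun ω => ?_
    unfold missInd
    by_cases hc : C.Couples (w n ω) <;> simp [hc]
  have hle : ∀ n, P E ≤ π x + miss n := by
    intro n
    -- If wⁿ couples, then N ≤ n, and nestedness forces 𝒮 ∘ wⁿ to be the singleton found at time N.
    have hsub : E ≤ᵐ[P] ({ω | (C.read (w n ω) : Set S) = {x}} ∪ {ω | ¬ C.Couples (w n ω)} :
        Set Ω) := by
      filter_upwards [hrun.ae_read_subset hmono] with ω hω hωE
      obtain ⟨k, hk, hkx⟩ := hωE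
      by_cases hc : C.Couples (w n ω)
      · have hkn : k ≤ n := by
          have := firstCoupling_le hc
          rw [hk] at this
          exact_mod_cast this
        exact Or.inl (read_eq_singleton_of_subset (hkx ▸ hω k n hkn))
      · exact Or.inr hc
    refine (measure_mono_ae hsub).trans ((measure_union_le _ _).trans ?_)
    rw [hpast, hnot]
    gcongr
    exact tsum_pastLaw_singleton_le hπ n x
  have hge : ∀ n, π x ≤ P E + miss n := by
    intro n
    have hsub : ({ω | (C.read (w n ω) : Set S) = {x}} : Set Ω) ≤ᵐ[P] E := by
      filter_upwards [hrun.ae_read_subset hmono] with ω hω hωx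
      have hc : C.Couples (w n ω) := ⟨x, hωx⟩
      obtain ⟨k, hk⟩ := ENat.ne_top_iff_exists.1
        (ne_top_of_le_ne_top (ENat.natCast_ne_top n) (firstCoupling_le hc))
      obtain ⟨y, hy⟩ := exists_couples_of_firstCoupling_eq hk.symm
      have hkn : k ≤ n := by
        have := firstCoupling_le hc
        rw [← hk] at this
        exact_mod_cast this
      have hxy := hω k n hkn
      rw [hy, show (C.read (w n ω) : Set S) = {x} from hωx, Set.singleton_subset_singleton] at hxy
      exact ⟨k, hk.symm, by rw [hy, hxy]⟩
    refine (le_tsum_pastLaw_singleton_add (C := C) hπ n x).trans ?_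
    rw [← hpast, ← hrun.lintegral_missInd]
    exact add_le_add_left (measure_mono_ae hsub) _
  have h1 := tendsto_const_nhds (x := π x) |>.add hmiss
  have h2 := tendsto_const_nhds (x := P E) |>.add hmiss
  rw [add_zero] at h1 h2
  exact le_antisymm (ge_of_tendsto' h1 hle) (ge_of_tendsto' h2 hge)

end BoundingChain

end OracleCFTP

end

theorem theorem2 {S A : Type*} [Finite S] [Finite A]
    (M : OracleCFTP.MarkovAutomaton S A) (C : OracleCFTP.BoundingChain M)
    (hmono : C.IsMonotone) (hsing : C.PreservesSingletons)
    (hcouple : ∃ v : List A, C.Couples (v.map some))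
    {Ω : Type*} [MeasurableSpace Ω] (P : Measure Ω) [IsProbabilityMeasure P]
    (u e w : ℕ → Ω → OracleCFTP.Word A) (hrun : C.IsRun P u e w) :
    P {ω | C.firstCoupling w ω < ⊤} = 1 ∧
    ∫⁻ ω, (C.firstCoupling w ω : ℝ≥0∞) ∂P < ∞ ∧
    ∃ π : PMF S, M.IsStationary π ∧ (∀ π' : PMF S, M.IsStationary π' → π' = π) ∧
      ∀ x : S, P {ω | ∃ n : ℕ, C.firstCoupling w ω = n ∧ (C.read (w n ω) : Set S) = {x}} = π x := by
  obtain ⟨v, hv⟩ := hcouple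
  have : Nonempty S := ⟨hv.choose⟩
  have hfin : ∫⁻ ω, ∑' n, C.missInd (w n ω) ∂P < ∞ := by
    rw [lintegral_tsum fun n => (hrun.measurable_missInd n).aemeasurable]
    exact hrun.tsum_missInd_lt_top hmono hsing hv
  refine ⟨?_, ?_, ?_⟩
  · have hae := ae_lt_top (Measurable.tsum fun n => hrun.measurable_missInd n) hfin.ne
    rw [← measure_univ (μ := P)]
    refine measure_congr ?_
    filter_upwards [hae] with ω hω
    refine propext ⟨fun _ => trivial, fun _ => ?_⟩
    refine lt_top_iff_ne_top.2 fun htop => ?_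
    have h1 := (OracleCFTP.BoundingChain.firstCoupling_le_tsum (C := C) (w := w) ω).trans_lt hω
    rw [htop] at h1
    exact absurd h1 (by simp)
  · exact (lintegral_mono fun ω => OracleCFTP.BoundingChain.firstCoupling_le_tsum ω).trans_lt hfin
  · obtain ⟨π, hπ⟩ := M.exists_isStationary
    refine ⟨π, hπ, fun π' hπ' => ?_, fun x => hrun.measure_stop_eq hmono hsing hv hπ x⟩
    ext x
    -- Both stationary laws equal the probability of the same stopping event.
    rw [← hrun.measure_stop_eq hmono hsing hv hπ x, hrun.measure_stop_eq hmono hsing hv hπ' x]
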